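/- Let $d\ge 1$. For $L\ge 0$ let $\mathrm{Lip}_L$ be the set of $L$-Lipschitz probability densities on $[0,1]$. For $k\ge1$ let $Q_{k,L}$ be the set of densities $p(x)=\sum_{i=1}^k w_i\prod_{j=1}^d p_{i,j}(x_j)$ on $[0,1)^d$ with $w$ a probability vector and all $p_{i,j}\in\mathrm{Lip}_L$, and let $\mathfrak Q_d=\bigcup_{k\ge1,\,L\ge0}Q_{k,L}$. For $b\ge 1$ let $\mathcal H_{1,b}$ be the convex hull of the functions $b\,\mathbf 1_{[(i-1)/b,\,i/b)}$, $1\le i\le b$, and let $\mathcal H^k_{d,b}$ be the set of functions $\sum_{i=1}^k w_i\prod_{j=1}^d q_{i,j}(x_j)$ with $w$ a probability vector and all $q_{i,j}\in\mathcal H_{1,b}$. An estimator $V_n\in\mathcal H^k_{d,b}$ is a (measurable) function of $X_1,\dots,X_n$ with values in $\mathcal H^k_{d,b}$. Below, $X_1,\dots,X_n$ are i.i.d. with density $p$ and $\|\cdot\|_1$ is the $L^1$ norm on $[0,1)^d$. (1) For all integers $n,k\ge1$ and real $L\ge2$, $0<\delta\le1$, there are $b\ge1$ and an estimator $V_n\in\mathcal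 H^k_{d,b}$ such that $$\sup_{p\in Q_{k,L}}P\left(\|V_n-p\|_1>\frac{21\,d\,k^{1/3}L^{\frac{d+3}{12}}}{n^{1/3}}\sqrt{\log(3Ldkn)}+7\sqrt{\frac{\log(3/\delta)}{2n}}\right)<\delta .$$ (2) For all integers $n,k\ge1$ and real $0\le L\le2$, $0<\delta\le1$, there are $b\ge1$ and an estimator $V_n\in\mathcal H^k_{d,b}$ such that $$\sup_{p\in Q_{k,L}}P\left(\|V_n-p\|_1>\frac{\sqrt d\,k^{1/3}}{n^{1/3}}\left[L^{1/3}\exp\left(\frac{L^2(d-1)}{24}\right)+20\sqrt{\log(7dnk)}\right]+7\sqrt{\frac{\log(3/\delta)}{2n}}\right)<\delta .$$ (3) There are sequences $b_n\ge 1$, $k_n\to\infty$ of positive integers and estimators $V_n\in\mathcal H^{k_n}_{d,b_n}$ that converge at the rate $\widetilde O(n^{-1/3})$, independent of $d$, on all of $\mathfrak Q_d$: for every $p\in\mathfrak Q_d$, $$P\left(\|V_n-p\|_1>n^{-1/3}\log n\right)\to0\qquad(n\to\infty).$$ -/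

import Mathlib

open MeasureTheory Filter Topology
open scoped NNReal ENNReal

noncomputable section

/-- The half-open unit cube `[0,1)^d` in `ℝ^d`. -/
def unitCube (d : ℕ) : Set (Fin d → ℝ) :=
  Set.univ.pi fun _ => Set.Ico (0 : ℝ) 1

/-- Lebesgue measure on the unit cube `[0,1)^d`. -/
def cubeMeasure (d : ℕ) : Measure (Fin d → ℝ) :=
  volume.restrict (unitCube d)

/-- The `L¹` distance on the unit cube, as an extended nonnegative real. -/
def l1Dist (d : ℕ) (f g : (Fin d → ℝ) → ℝ) : ℝ≥0∞ :=
  eLpNorm (fun x => f x - g x) 1 (cubeMeasure d)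

/-- The distribution on the unit cube whose density is `p`. -/
def densityMeasure (d : ℕ) (p : (Fin d → ℝ) → ℝ) : Measure (Fin d → ℝ) :=
  (cubeMeasure d).withDensity fun x => ENNReal.ofReal (p x)

/-- The joint distribution of `n` independent samples from the density `p`. -/
def sampleMeasure (d n : ℕ) (p : (Fin d → ℝ) → ℝ) : Measure (Fin n → Fin d → ℝ) :=
  Measure.pi fun _ => densityMeasure d p

/-- The functions `∑ i, w i * ∏ j, f i j (x j)` with `k` components, where `w` is a probability
vector and all component marginals `f i j` belong to the class `F`. -/
def multiView (d k : ℕ) (F : Set (ℝ → ℝ)) : Set ((Fin d → ℝ) → ℝ) :=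
  {p | ∃ w ∈ stdSimplex ℝ (Fin k), ∃ f : Fin k → Fin d → ℝ → ℝ,
    (∀ i j, f i j ∈ F) ∧ p = fun x => ∑ i, w i * ∏ j, f i j (x j)}

/-- The one-dimensional histogram with `b` bins all of whose weight lies in bin `i`
(bins are numbered from `0`). -/
def binHist (b : ℕ) (i : Fin b) : ℝ → ℝ :=
  (Set.Ico ((i : ℝ) / b) (((i : ℝ) + 1) / b)).indicator fun _ => (b : ℝ)

/-- One-dimensional histograms on `[0,1)` with `b` bins. -/
def hist1 (b : ℕ) : Set (ℝ → ℝ) :=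
  convexHull ℝ (Set.range (binHist b))

/-- Multi-view histograms: `d` dimensions, `b` bins per dimension, `k` components. -/
def multiViewHist (d b k : ℕ) : Set ((Fin d → ℝ) → ℝ) :=
  multiView d k (hist1 b)

/-- `L`-Lipschitz probability densities on `[0,1]`. -/
def lipDensity (L : ℝ≥0) : Set (ℝ → ℝ) :=
  {f | LipschitzOnWith L f (Set.Icc 0 1) ∧ (∀ x ∈ Set.Icc (0 : ℝ) 1, 0 ≤ f x) ∧
    ∫ x in Set.Icc (0 : ℝ) 1, f x = 1}

/-- `k`-component multi-view densities with `L`-Lipschitz component marginals. -/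
def lipMultiView (d k : ℕ) (L : ℝ≥0) : Set ((Fin d → ℝ) → ℝ) :=
  multiView d k (lipDensity L)

/-- All multi-view densities with Lipschitz component marginals, with any number of components
and any Lipschitz constant. -/
def allLipMultiView (d : ℕ) : Set ((Fin d → ℝ) → ℝ) :=
  {p | ∃ (k : ℕ) (L : ℝ≥0), p ∈ lipMultiView d k L}

/-- `V` is an estimator with values in the multi-view histograms: a (jointly measurable) function
of the sample `X` whose value is always an element of the class `multiViewHist d b k`. -/
structure IsHistEstimator (d n b k : ℕ)
    (V : (Fin n → Fin d → ℝ) → (Fin d → ℝ) → ℝ) : Prop where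
  mem : ∀ X, V X ∈ multiViewHist d b k
  measurable : Measurable (Function.uncurry V)

end

/-! Discretise the class and select from the finite family by minimum distance. Rounding all weights
of a multi-view histogram to multiples of `1 / n` leaves at most `(n + 1) ^ (k + b * d * k)`
candidates, so the logarithm of their number is of order `k * d * b * log n`: it is linear in `b`,
and `b ^ d` never appears. Likewise the `L¹` error of a product of densities is at most the sum of
the errors of its factors, so the bias is about `d * L / b`. This is why the rate does not depend on
`d`.

Selection compares the candidates on the sets where one exceeds another
(`exists_minimum_distance_selector`). Up to three times the best approximation error, its price is
the uniform deviation of the empirical frequencies on these sets, which Hoeffding's inequality and a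
union bound control at order `√(k * d * b * log n / n)`. With the approximation bound
`exists_histGrid_close` this gives `exists_histEstimator`, whose estimator depends on neither `L`
nor `δ`.

Taking `b` of order `(n / k) ^ (1 / 3)`, up to factors in `d` and `L`, makes both errors of order
`(k / n) ^ (1 / 3)` up to logarithms, which yields the two finite-sample bounds. For the universal
sequence, `k` grows like `√(log n)`: every fixed mixture is eventually covered, and the loss in the
rate stays below `log n`. -/

/-- A probability density with respect to the measure `ν`. -/
structure IsDensity {E : Type*} [MeasurableSpace E] (ν : Measure E) (f : E → ℝ) : Prop where
  nonneg : 0 ≤ᵐ[ν] f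
  integrable : Integrable f ν
  integral_eq_one : ∫ x, f x ∂ν = 1

/-! ### Measurable minimisation and concentration of empirical frequencies -/

/-- Candidates are added one at a time; the new one replaces the current choice on the measurable
set where it does at least as well. Measurability of the current minimum is carried along in the
induction. -/
lemma exists_measurable_argmin {Ω ι : Type*} [MeasurableSpace Ω] [MeasurableSpace ι] [Fintype ι]
    [Nonempty ι] (Δ : ι → Ω → ℝ) (hΔ : ∀ i, Measurable (Δ i)) :
    ∃ s : Ω → ι, Measurable s ∧ ∀ ω j, Δ (s ω) ω ≤ Δ j ω := by
  classical
  have key : ∀ S : Finset ι, S.Nonempty → ∃ s : Ω → ι, Measurable s ∧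
      Measurable (fun ω => Δ (s ω) ω) ∧ ∀ ω, ∀ j ∈ S, Δ (s ω) ω ≤ Δ j ω := by
    intro S hS
    induction hS using Finset.Nonempty.cons_induction with
    | singleton a => exact ⟨fun _ => a, measurable_const, hΔ a, by simp⟩
    | cons a S ha hS ih =>
      obtain ⟨s, hs, hms, hle⟩ := ih
      have hset : MeasurableSet {ω | Δ a ω ≤ Δ (s ω) ω} := measurableSet_le (hΔ a) hms
      refine ⟨fun ω => if Δ a ω ≤ Δ (s ω) ω then a else s ω,
        Measurable.ite hset measurable_const hs, ?_, ?_⟩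
      · have : (fun ω => Δ (if Δ a ω ≤ Δ (s ω) ω then a else s ω) ω)
            = fun ω => min (Δ a ω) (Δ (s ω) ω) := by
          funext ω
          split_ifs with h
          · rw [min_eq_left h]
          · rw [min_eq_right (not_le.mp h).le]
        rw [this]
        exact (hΔ a).min hms
      · intro ω j hj
        rw [Finset.mem_cons] at hj
        dsimp only
        split_ifs with h
        · rcases hj with rfl | hj
          · exact le_rfl
          · exact h.trans (hle ω j hj)
        · rcases hj with rfl | hj
          · exact (not_le.mp h).le
          · exact hle ω j hj
  obtain ⟨s, hs, -, hle⟩ := key Finset.univ Finset.univ_nonempty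
  exact ⟨s, hs, fun ω j => hle ω j (Finset.mem_univ j)⟩

/-- The fraction of the sample points that lie in `A`. -/
noncomputable def empiricalFreq {E : Type*} {n : ℕ} (A : Set E) (X : Fin n → E) : ℝ :=
  (∑ i, A.indicator (fun _ => (1 : ℝ)) (X i)) / n

lemma measurable_empiricalFreq {E : Type*} [MeasurableSpace E] {n : ℕ} {A : Set E}
    (hA : MeasurableSet A) : Measurable (empiricalFreq (n := n) A) := by
  unfold empiricalFreq
  refine Measurable.div_const (Finset.measurable_sum _ fun i _ => ?_) _
  exact (measurable_const.indicator hA).comp (measurable_pi_apply i)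

/-- By Hoeffding's lemma a centred indicator is sub-Gaussian with variance proxy `1 / 4`, so the sum
over the sample has proxy `n / 4`. Applying the one-sided tail bound to the variable and to its
negative gives the factor 2. -/
lemma hoeffding_empiricalFreq {E : Type*} [MeasurableSpace E] (μ : Measure E)
    [IsProbabilityMeasure μ] {n : ℕ} (hn : 1 ≤ n) {A : Set E} (hA : MeasurableSet A) {ε : ℝ}
    (hε : 0 ≤ ε) :
    (Measure.pi fun _ : Fin n => μ).real {X | ε ≤ |empiricalFreq A X - μ.real A|}
      ≤ 2 * Real.exp (-2 * n * ε ^ 2) := by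
  have hn' : (0 : ℝ) < n := by exact_mod_cast hn
  set Y : E → ℝ := fun x => A.indicator (fun _ => (1 : ℝ)) x - μ.real A with hY
  have hYm : Measurable Y := (measurable_const.indicator hA).sub_const _
  have hsub : ProbabilityTheory.HasSubgaussianMGF Y ((‖(1 : ℝ) - 0‖₊ / 2) ^ 2) μ := by
    have h := ProbabilityTheory.hasSubgaussianMGF_of_mem_Icc (μ := μ) (a := 0) (b := 1)
      (X := A.indicator (fun _ => (1 : ℝ))) (measurable_const.indicator hA).aemeasurable
      (Filter.Eventually.of_forall fun ω => by
        by_cases h : ω ∈ A <;> simp [h])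
    have h1 : ∫ x, A.indicator (fun _ => (1 : ℝ)) x ∂μ = μ.real A := by
      rw [integral_indicator hA]; simp
    rwa [h1] at h
  have hc : (∑ _i : Fin n, ((‖(1 : ℝ) - 0‖₊ / 2) ^ 2 : ℝ≥0) : ℝ≥0) = n / 4 := by
    rw [Finset.sum_const, Finset.card_univ, Fintype.card_fin, nsmul_eq_mul]
    simp
    rw [div_eq_mul_inv]
    norm_num
  have heval : ∀ i : Fin n, (Measure.pi fun _ : Fin n => μ).map (Function.eval i) = μ := fun i =>
    (measurePreserving_eval (fun _ : Fin n => μ) i).map_eq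
  have hS : ∀ Z : E → ℝ, Measurable Z →
      ProbabilityTheory.HasSubgaussianMGF Z ((‖(1 : ℝ) - 0‖₊ / 2) ^ 2) μ →
      (Measure.pi fun _ : Fin n => μ).real {X | n * ε ≤ ∑ i, Z (X i)}
        ≤ Real.exp (-2 * n * ε ^ 2) := by
    intro Z hZ hZs
    have hind := ProbabilityTheory.iIndepFun_pi (μ := fun _ : Fin n => μ) (X := fun _ => Z)
      (fun _ => hZ.aemeasurable)
    have h := ProbabilityTheory.HasSubgaussianMGF.measure_sum_ge_le_of_iIndepFun hind
      (c := fun _ => (‖(1 : ℝ) - 0‖₊ / 2) ^ 2) (s := Finset.univ) (ε := n * ε) (fun i _ => by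
        have := ProbabilityTheory.HasSubgaussianMGF.of_map (X := Z)
          (μ := Measure.pi fun _ : Fin n => μ) (Y := Function.eval i)
          (measurable_pi_apply i).aemeasurable (by rw [heval]; exact hZs)
        exact this) (by positivity)
    refine h.trans (le_of_eq ?_)
    rw [hc]
    congr 1
    push_cast
    field_simp
    ring
  have h1 := hS Y hYm hsub
  have h2 := hS (-Y) hYm.neg hsub.neg
  have hsubset : {X : Fin n → E | ε ≤ |empiricalFreq A X - μ.real A|} ⊆
      {X | n * ε ≤ ∑ i, Y (X i)} ∪ {X | n * ε ≤ ∑ i, (-Y) (X i)} := by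
    intro X hX
    have hYX : ∑ i, Y (X i) = n * (empiricalFreq A X - μ.real A) := by
      simp only [hY, empiricalFreq, Finset.sum_sub_distrib, Finset.sum_const, Finset.card_univ,
        Fintype.card_fin, nsmul_eq_mul]
      field_simp
    have hX' : ε ≤ |empiricalFreq A X - μ.real A| := hX
    rcases le_abs.mp hX' with h | h
    · left
      change n * ε ≤ ∑ i, Y (X i)
      rw [hYX]; gcongr
    · right
      change n * ε ≤ ∑ i, (-Y) (X i)
      simp only [Pi.neg_apply, Finset.sum_neg_distrib]
      rw [hYX, ← mul_neg]; gcongr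
  calc _ ≤ _ := measureReal_mono hsubset
    _ ≤ _ := measureReal_union_le _ _
    _ ≤ _ := by linarith

/-! ### Densities and their `L¹` distance -/

section L1

variable {E : Type*} [MeasurableSpace E] {ν : Measure E} {f g : E → ℝ}

/-- Since `f - g` has integral zero, its integrals over `A` and over the complement are opposite, so
each takes at most half of the `L¹` norm. -/
lemma IsDensity.abs_setIntegral_sub_le (hf : IsDensity ν f) (hg : IsDensity ν g) {A : Set E}
    (hA : MeasurableSet A) :
    |∫ x in A, f x ∂ν - ∫ x in A, g x ∂ν| ≤ (∫ x, |f x - g x| ∂ν) / 2 := by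
  have hi : Integrable (fun x => f x - g x) ν := hf.integrable.sub hg.integrable
  have h0 : ∫ x, f x - g x ∂ν = 0 := by
    rw [integral_sub hf.integrable hg.integrable, hf.integral_eq_one, hg.integral_eq_one, sub_self]
  have h1 := integral_add_compl hA hi
  have h2 := integral_add_compl hA hi.abs
  have h3 : |∫ x in A, f x - g x ∂ν| ≤ ∫ x in A, |f x - g x| ∂ν := abs_integral_le_integral_abs
  have h4 : |∫ x in Aᶜ, f x - g x ∂ν| ≤ ∫ x in Aᶜ, |f x - g x| ∂ν := abs_integral_le_integral_abs
  rw [h0] at h1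
  rw [← integral_sub hf.integrable.integrableOn hg.integrable.integrableOn]
  have h5 : |∫ x in Aᶜ, f x - g x ∂ν| = |∫ x in A, f x - g x ∂ν| := by
    rw [← abs_neg]; congr 1; linarith
  linarith

/-- Scheffé's identity: the positive part of `f - g` carries exactly half of the `L¹` distance. -/
lemma IsDensity.integral_abs_sub_eq (hf : IsDensity ν f) (hg : IsDensity ν g)
    (hm : MeasurableSet {x | g x < f x}) :
    ∫ x, |f x - g x| ∂ν
      = 2 * (∫ x in {x | g x < f x}, f x ∂ν - ∫ x in {x | g x < f x}, g x ∂ν) := by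
  have hi : Integrable (fun x => f x - g x) ν := hf.integrable.sub hg.integrable
  have h0 : ∫ x, f x - g x ∂ν = 0 := by
    rw [integral_sub hf.integrable hg.integrable, hf.integral_eq_one, hg.integral_eq_one, sub_self]
  have h1 := integral_add_compl hm hi
  have h2 : ∫ x in {x | g x < f x}, |f x - g x| ∂ν + ∫ x in {x | g x < f x}ᶜ, |f x - g x| ∂ν
      = ∫ x, |f x - g x| ∂ν := integral_add_compl hm hi.abs
  have h3 : ∫ x in {x | g x < f x}, |f x - g x| ∂ν = ∫ x in {x | g x < f x}, f x - g x ∂ν :=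
    setIntegral_congr_fun hm fun x hx => abs_of_pos (sub_pos.mpr hx)
  have h4 : ∫ x in {x | g x < f x}ᶜ, |f x - g x| ∂ν = ∫ x in {x | g x < f x}ᶜ, -(f x - g x) ∂ν :=
    setIntegral_congr_fun hm.compl fun x hx =>
      abs_of_nonpos (sub_nonpos.mpr (not_lt.mp hx))
  rw [integral_neg] at h4
  rw [← integral_sub hf.integrable.integrableOn hg.integrable.integrableOn]
  linarith

lemma integral_abs_sub_triangle {h : E → ℝ} (hf : Integrable f ν) (hg : Integrable g ν)
    (hh : Integrable h ν) :
    ∫ x, |f x - h x| ∂ν ≤ ∫ x, |f x - g x| ∂ν + ∫ x, |g x - h x| ∂ν := by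
  have hadd : ∫ x, |f x - g x| + |g x - h x| ∂ν
      = ∫ x, |f x - g x| ∂ν + ∫ x, |g x - h x| ∂ν :=
    integral_add (hf.sub hg).abs (hg.sub hh).abs
  rw [← hadd]
  exact integral_mono (hf.sub hh).abs ((hf.sub hg).abs.add (hg.sub hh).abs)
    fun x => abs_sub_le (f x) (g x) (h x)

lemma IsDensity.integral_abs_sub_le_two (hf : IsDensity ν f) (hg : IsDensity ν g) :
    ∫ x, |f x - g x| ∂ν ≤ 2 := by
  have h := integral_abs_sub_triangle (g := fun _ => (0 : ℝ)) hf.integrable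
    (integrable_zero E ℝ ν) hg.integrable
  have h1 : ∫ x, |f x - (0 : ℝ)| ∂ν = 1 := by
    rw [← hf.integral_eq_one]
    refine integral_congr_ae ?_
    filter_upwards [hf.nonneg] with x hx
    simpa using hx
  have h2 : ∫ x, |(0 : ℝ) - g x| ∂ν = 1 := by
    rw [← hg.integral_eq_one]
    refine integral_congr_ae ?_
    filter_upwards [hg.nonneg] with x hx
    simpa using hx
  linarith

lemma IsDensity.isProbabilityMeasure (hf : IsDensity ν f) :
    IsProbabilityMeasure (ν.withDensity fun x => ENNReal.ofReal (f x)) := by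
  constructor
  rw [withDensity_apply _ MeasurableSet.univ, Measure.restrict_univ,
    ← ofReal_integral_eq_lintegral_ofReal hf.integrable hf.nonneg, hf.integral_eq_one,
    ENNReal.ofReal_one]

lemma IsDensity.measureReal_withDensity (hf : IsDensity ν f) {A : Set E} (hA : MeasurableSet A) :
    (ν.withDensity fun x => ENNReal.ofReal (f x)).real A = ∫ x in A, f x ∂ν := by
  rw [measureReal_def, withDensity_apply _ hA,
    ← ofReal_integral_eq_lintegral_ofReal hf.integrable.integrableOn
      (ae_restrict_of_ae hf.nonneg),
    ENNReal.toReal_ofReal (integral_nonneg_of_ae (ae_restrict_of_ae hf.nonneg))]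

end L1

/-! ### Minimum distance selection -/

/-- Minimum distance selection from a finite family of densities. -/
theorem exists_minimum_distance_selector {E ι : Type*} [MeasurableSpace E] {ν : Measure E}
    [Fintype ι] [Nonempty ι] (n : ℕ) (f : ι → E → ℝ)
    (hfm : ∀ i, Measurable (f i)) (hf : ∀ i, IsDensity ν (f i)) :
    ∃ s : (Fin n → E) → ι, Measurable (Function.uncurry fun X => f (s X)) ∧
      ∀ p : E → ℝ, IsDensity ν p → 1 ≤ n → ∀ ε : ℝ, 0 ≤ ε →
      (Measure.pi fun _ : Fin n => ν.withDensity fun x => ENNReal.ofReal (p x)).real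
        {X | ¬ ∀ i, ∫ x, |f (s X) x - p x| ∂ν ≤ 3 * ∫ x, |f i x - p x| ∂ν + 4 * ε}
        ≤ 2 * (Fintype.card ι : ℝ) ^ 2 * Real.exp (-2 * n * ε ^ 2) := by
  classical
  -- These are the Scheffé sets of all pairs. `Δ i` is the worst discrepancy on them between
  -- candidate `i` and the sample, and the selector minimises it.
  set A : ι × ι → Set E := fun q => {x | f q.2 x < f q.1 x} with hAdef
  have hA : ∀ q, MeasurableSet (A q) := fun q => measurableSet_lt (hfm q.2) (hfm q.1)
  set Δ : ι → (Fin n → E) → ℝ := fun i =>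
    Finset.univ.sup' Finset.univ_nonempty fun (q : ι × ι) (X : Fin n → E) =>
      |∫ x in A q, f i x ∂ν - empiricalFreq (A q) X| with hΔdef
  have hΔm : ∀ i, Measurable (Δ i) := fun i =>
    Finset.measurable_sup' _ fun q _ =>
      (measurable_const.sub (measurable_empiricalFreq (hA q))).abs
  have hleΔ : ∀ i X q, |∫ x in A q, f i x ∂ν - empiricalFreq (A q) X| ≤ Δ i X := by
    intro i X q
    simp only [hΔdef, Finset.sup'_apply]
    exact Finset.le_sup' (fun q => |∫ x in A q, f i x ∂ν - empiricalFreq (A q) X|)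
      (Finset.mem_univ q)
  have hΔle : ∀ i X c, (∀ q, |∫ x in A q, f i x ∂ν - empiricalFreq (A q) X| ≤ c) → Δ i X ≤ c := by
    intro i X c h
    simp only [hΔdef, Finset.sup'_apply]
    exact Finset.sup'_le _ _ fun q _ => h q
  -- With the discrete σ-algebra on the finite index set, joint measurability in sample and point
  -- reduces to measurability of each candidate.
  let _ : MeasurableSpace ι := ⊤
  obtain ⟨s, hs, hmin⟩ := exists_measurable_argmin Δ hΔm
  have hfm' : Measurable fun q : ι × E => f q.1 q.2 := measurable_from_prod_countable_right hfm
  refine ⟨s, hfm'.comp ((hs.comp measurable_fst).prodMk measurable_snd), fun p hp hn ε hε => ?_⟩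
  set μ := ν.withDensity fun x => ENNReal.ofReal (p x) with hμ
  have : IsProbabilityMeasure μ := hp.isProbabilityMeasure
  have hsubset : {X | ¬ ∀ i, ∫ x, |f (s X) x - p x| ∂ν ≤ 3 * ∫ x, |f i x - p x| ∂ν + 4 * ε} ⊆
      ⋃ q ∈ (Finset.univ : Finset (ι × ι)),
        {X : Fin n → E | ε ≤ |empiricalFreq (A q) X - μ.real (A q)|} := by
    intro X hX
    by_contra hcon
    simp only [Set.mem_iUnion, Set.mem_ofPred_eq, Finset.mem_univ, exists_prop, true_and,
      not_exists, not_le] at hcon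
    apply hX
    intro i
    have hΔi : Δ i X ≤ (∫ x, |f i x - p x| ∂ν) / 2 + ε := by
      refine hΔle _ _ _ fun q => ?_
      have h1 := (hf i).abs_setIntegral_sub_le hp (hA q)
      have h2 := hcon q
      rw [hμ, hp.measureReal_withDensity (hA q), abs_sub_comm] at h2
      exact (abs_sub_le _ (∫ x in A q, p x ∂ν) _).trans (by linarith)
    have hΔs := hmin X i
    -- The distance from `f (s X)` to `f i` is at most `2 * (Δ (s X) X + Δ i X) ≤ 4 * Δ i X`, hence
    -- at most twice the distance from `f i` to `p` plus `4 * ε`. The triangle inequality raises the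
    -- factor 2 to 3.
    have h3 := (hf (s X)).integral_abs_sub_eq (hf i) (hA (s X, i))
    have h4 := (le_abs_self _).trans (hleΔ (s X) X (s X, i))
    have h5 := (neg_le_abs _).trans (hleΔ i X (s X, i))
    have h6 := integral_abs_sub_triangle (hf (s X)).integrable (hf i).integrable hp.integrable
    simp only [hAdef] at h4 h5
    linarith
  calc _ ≤ _ := measureReal_mono hsubset (measure_ne_top _ _)
    _ ≤ ∑ q ∈ (Finset.univ : Finset (ι × ι)), (Measure.pi fun _ : Fin n => μ).real
        {X : Fin n → E | ε ≤ |empiricalFreq (A q) X - μ.real (A q)|} :=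
      measureReal_biUnion_finset_le _ _
    _ ≤ ∑ q ∈ (Finset.univ : Finset (ι × ι)), 2 * Real.exp (-2 * n * ε ^ 2) :=
      Finset.sum_le_sum fun q _ => hoeffding_empiricalFreq μ hn (hA q) hε
    _ = _ := by
      rw [Finset.sum_const, Finset.card_univ, Fintype.card_prod, nsmul_eq_mul]
      push_cast
      ring

/-! ### Products and mixtures of densities -/

section Mixtures

variable {E κ : Type*} [MeasurableSpace E] {ν : Measure E} [Fintype κ]

lemma IsDensity.prod [SigmaFinite ν] {f : κ → E → ℝ} (hf : ∀ j, IsDensity ν (f j)) :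
    IsDensity (Measure.pi fun _ : κ => ν) (fun x => ∏ j, f j (x j)) where
  nonneg := by
    have h : ∀ᵐ x ∂(Measure.pi fun _ : κ => ν), ∀ j, 0 ≤ f j (x j) :=
      ae_all_iff.mpr fun j =>
        (Measure.quasiMeasurePreserving_eval (fun _ : κ => ν) j).ae (hf j).nonneg
    filter_upwards [h] with x hx
    exact Finset.prod_nonneg fun j _ => hx j
  integrable := Integrable.fintype_prod fun j => (hf j).integrable
  integral_eq_one := by
    rw [integral_fintype_prod_eq_prod (μ := fun _ : κ => ν) f]
    exact Finset.prod_eq_one fun j _ => (hf j).integral_eq_one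

lemma IsDensity.sum {f : κ → E → ℝ} (hf : ∀ i, IsDensity ν (f i)) {w : κ → ℝ}
    (hw : w ∈ stdSimplex ℝ κ) : IsDensity ν (fun x => ∑ i, w i * f i x) where
  nonneg := by
    have h : ∀ᵐ x ∂ν, ∀ i, 0 ≤ f i x := ae_all_iff.mpr fun i => (hf i).nonneg
    filter_upwards [h] with x hx
    exact Finset.sum_nonneg fun i _ => mul_nonneg (hw.1 i) (hx i)
  integrable := integrable_finsetSum _ fun i _ => (hf i).integrable.const_mul _
  integral_eq_one := by
    rw [integral_finsetSum _ fun i _ => (hf i).integrable.const_mul _]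
    simp_rw [integral_const_mul, (hf _).integral_eq_one, mul_one]
    exact hw.2

lemma IsDensity.integral_abs_eq_one {f : E → ℝ} (hf : IsDensity ν f) : ∫ x, |f x| ∂ν = 1 := by
  rw [← hf.integral_eq_one]
  refine integral_congr_ae ?_
  filter_upwards [hf.nonneg] with x hx
  exact abs_of_nonneg hx

/-- Split `w i * f i - v i * g i` as `w i * (f i - g i) + (w i - v i) * g i`. Only `w` has to be a
probability vector. -/
lemma integral_abs_mixture_sub_le {f g : κ → E → ℝ} (hf : ∀ i, IsDensity ν (f i))
    (hg : ∀ i, IsDensity ν (g i)) {w v : κ → ℝ} (hw : w ∈ stdSimplex ℝ κ) {c : ℝ}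
    (hc : ∀ i, ∫ x, |f i x - g i x| ∂ν ≤ c) :
    ∫ x, |∑ i, w i * f i x - ∑ i, v i * g i x| ∂ν ≤ ∑ i, |w i - v i| + c := by
  have hint1 : ∀ i, Integrable (fun x => w i * |f i x - g i x|) ν := fun i =>
    ((hf i).integrable.sub (hg i).integrable).abs.const_mul _
  have hint2 : ∀ i, Integrable (fun x => |w i - v i| * |g i x|) ν := fun i =>
    (hg i).integrable.abs.const_mul _
  have hpt : ∀ x, |∑ i, w i * f i x - ∑ i, v i * g i x|
      ≤ ∑ i, (w i * |f i x - g i x| + |w i - v i| * |g i x|) := by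
    intro x
    rw [← Finset.sum_sub_distrib]
    refine (Finset.abs_sum_le_sum_abs _ _).trans (Finset.sum_le_sum fun i _ => ?_)
    have : w i * f i x - v i * g i x = w i * (f i x - g i x) + (w i - v i) * g i x := by ring
    rw [this]
    refine (abs_add_le _ _).trans (le_of_eq ?_)
    rw [abs_mul, abs_mul, abs_of_nonneg (hw.1 i)]
  have hint : Integrable (fun x => |∑ i, w i * f i x - ∑ i, v i * g i x|) ν :=
    ((integrable_finsetSum _ fun i _ => (hf i).integrable.const_mul _).sub
      (integrable_finsetSum _ fun i _ => (hg i).integrable.const_mul _)).abs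
  calc _ ≤ ∫ x, ∑ i, (w i * |f i x - g i x| + |w i - v i| * |g i x|) ∂ν :=
        integral_mono hint (integrable_finsetSum _ fun i _ => (hint1 i).add (hint2 i)) hpt
    _ = ∑ i, (w i * ∫ x, |f i x - g i x| ∂ν + |w i - v i|) := by
        have hint12 : ∀ i, Integrable (fun x => w i * |f i x - g i x| + |w i - v i| * |g i x|) ν :=
          fun i => (hint1 i).add (hint2 i)
        rw [integral_finsetSum _ fun i _ => hint12 i]
        refine Finset.sum_congr rfl fun i _ => ?_
        rw [integral_add (hint1 i) (hint2 i), integral_const_mul, integral_const_mul,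
          (hg i).integral_abs_eq_one, mul_one]
    _ ≤ ∑ i, (w i * c + |w i - v i|) :=
        Finset.sum_le_sum fun i _ => by
          have := mul_le_mul_of_nonneg_left (hc i) (hw.1 i)
          linarith
    _ = _ := by
        rw [Finset.sum_add_distrib, ← Finset.sum_mul, hw.2, one_mul, add_comm]

/-- Exchange the factors one at a time. Each exchange costs only the distance between the two
factors, because all other factors have integral one. -/
lemma integral_abs_prod_sub_le [SigmaFinite ν] {f g : κ → E → ℝ} (hf : ∀ j, IsDensity ν (f j))
    (hg : ∀ j, IsDensity ν (g j)) :
    ∫ x, |∏ j, f j (x j) - ∏ j, g j (x j)| ∂(Measure.pi fun _ : κ => ν)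
      ≤ ∑ j, ∫ x, |f j x - g j x| ∂ν := by
  classical
  set h : Finset κ → κ → E → ℝ := fun S j => if j ∈ S then f j else g j with hh
  have hd : ∀ S j, IsDensity ν (h S j) := by
    intro S j
    simp only [hh]
    split_ifs
    exacts [hf j, hg j]
  have key : ∀ S : Finset κ,
      ∫ x, |∏ j, h S j (x j) - ∏ j, g j (x j)| ∂(Measure.pi fun _ : κ => ν)
        ≤ ∑ j ∈ S, ∫ x, |f j x - g j x| ∂ν := by
    intro S
    induction S using Finset.induction_on with
    | empty => simp [hh]
    | insert a S ha ih =>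
      rw [Finset.sum_insert ha]
      refine (integral_abs_sub_triangle (IsDensity.prod (hd (insert a S))).integrable
        (IsDensity.prod (hd S)).integrable (IsDensity.prod hg).integrable).trans
        (add_le_add (le_of_eq ?_) ih)
      -- Consecutive hybrids differ only in coordinate `a`, so the absolute value of their
      -- difference is again a product and its integral factorises.
      set u : κ → E → ℝ := fun j => if j = a then fun x => |f a x - g a x| else fun x => |h S j x|
        with hu
      have hpt : ∀ x : κ → E, |∏ j, h (insert a S) j (x j) - ∏ j, h S j (x j)|
          = ∏ j, u j (x j) := by
        intro x
        rw [← Finset.mul_prod_erase _ _ (Finset.mem_univ a),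
          ← Finset.mul_prod_erase _ (fun j => h S j (x j)) (Finset.mem_univ a),
          ← Finset.mul_prod_erase _ (fun j => u j (x j)) (Finset.mem_univ a)]
        have e1 : ∏ j ∈ Finset.univ.erase a, h (insert a S) j (x j)
            = ∏ j ∈ Finset.univ.erase a, h S j (x j) :=
          Finset.prod_congr rfl fun j hj => by
            simp [hh, Finset.ne_of_mem_erase hj]
        have e2 : ∏ j ∈ Finset.univ.erase a, u j (x j)
            = ∏ j ∈ Finset.univ.erase a, |h S j (x j)| :=
          Finset.prod_congr rfl fun j hj => by
            simp [hu, Finset.ne_of_mem_erase hj]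
        rw [e1, e2, ← sub_mul, abs_mul, Finset.abs_prod]
        simp [hh, hu, ha]
      simp_rw [hpt]
      rw [integral_fintype_prod_eq_prod (μ := fun _ : κ => ν) u,
        ← Finset.mul_prod_erase _ _ (Finset.mem_univ a),
        Finset.prod_eq_one fun j hj => by
          simpa [hu, Finset.ne_of_mem_erase hj] using (hd S j).integral_abs_eq_one]
      simp [hu]
  simpa [hh] using key Finset.univ

end Mixtures

/-! ### One-dimensional histograms and their approximation error -/

/-- Lebesgue measure on the unit interval `[0,1)`. -/
noncomputable abbrev unitMeasure : Measure ℝ := volume.restrict (Set.Ico (0 : ℝ) 1)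

lemma cubeMeasure_eq_pi (d : ℕ) : cubeMeasure d = Measure.pi fun _ : Fin d => unitMeasure := by
  rw [cubeMeasure, unitCube, volume_pi, Measure.restrict_pi_pi]

lemma isDensity_of_mem_multiView {d k : ℕ} {F : Set (ℝ → ℝ)}
    (hF : ∀ f ∈ F, IsDensity unitMeasure f) {p : (Fin d → ℝ) → ℝ} (hp : p ∈ multiView d k F) :
    IsDensity (cubeMeasure d) p := by
  obtain ⟨w, hw, f, hf, rfl⟩ := hp
  rw [cubeMeasure_eq_pi]
  exact IsDensity.sum (fun i => IsDensity.prod fun j => hF _ (hf i j)) hw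

lemma l1Dist_eq_ofReal {d : ℕ} {f g : (Fin d → ℝ) → ℝ} (hf : IsDensity (cubeMeasure d) f)
    (hg : IsDensity (cubeMeasure d) g) :
    l1Dist d f g = ENNReal.ofReal (∫ x, |f x - g x| ∂(cubeMeasure d)) := by
  rw [l1Dist, eLpNorm_one_eq_lintegral_enorm]
  exact (ofReal_integral_norm_eq_lintegral_enorm (hf.integrable.sub hg.integrable)).symm

lemma isDensity_of_mem_lipDensity {L : ℝ≥0} {f : ℝ → ℝ} (hf : f ∈ lipDensity L) :
    IsDensity unitMeasure f := by
  obtain ⟨hL, h0, h1⟩ := hf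
  refine ⟨?_, ?_, ?_⟩
  · exact (ae_restrict_iff' measurableSet_Ico).mpr
      (Eventually.of_forall fun x hx => h0 x (Set.Ico_subset_Icc_self hx))
  · exact (hL.continuousOn.integrableOn_compact isCompact_Icc).mono_set Set.Ico_subset_Icc_self
  · rw [← h1, integral_Icc_eq_integral_Ico]

lemma measurable_binHist (b : ℕ) (i : Fin b) : Measurable (binHist b i) :=
  measurable_const.indicator measurableSet_Ico

lemma bin_subset {b : ℕ} (i : Fin b) :
    Set.Ico ((i : ℝ) / b) (((i : ℝ) + 1) / b) ⊆ Set.Ico 0 1 := by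
  have hb : (0 : ℝ) < b := by exact_mod_cast i.pos
  have hi : (i : ℝ) + 1 ≤ b := by exact_mod_cast i.isLt
  refine Set.Ico_subset_Ico (by positivity) ?_
  rwa [div_le_one hb]

lemma integral_unitMeasure_indicator_bin {b : ℕ} (i : Fin b) (f : ℝ → ℝ) :
    ∫ x, (Set.Ico ((i : ℝ) / b) (((i : ℝ) + 1) / b)).indicator f x ∂unitMeasure
      = ∫ x in Set.Ico ((i : ℝ) / b) (((i : ℝ) + 1) / b), f x := by
  rw [integral_indicator measurableSet_Ico, Measure.restrict_restrict measurableSet_Ico,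
    Set.inter_eq_left.mpr (bin_subset i)]

lemma isDensity_binHist {b : ℕ} (i : Fin b) : IsDensity unitMeasure (binHist b i) where
  nonneg := Eventually.of_forall fun x => Set.indicator_nonneg (fun _ _ => by positivity) x
  integrable := (integrable_const _).indicator measurableSet_Ico
  integral_eq_one := by
    have hb : (0 : ℝ) < b := by exact_mod_cast i.pos
    rw [binHist, integral_unitMeasure_indicator_bin]
    rw [setIntegral_const, Real.volume_real_Ico_of_le (by gcongr; linarith), smul_eq_mul]
    field_simp
    ring

/-- The histogram with bin weights `w`. -/
noncomputable def histOf {b : ℕ} (w : Fin b → ℝ) (x : ℝ) : ℝ := ∑ a, w a * binHist b a x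

lemma measurable_histOf {b : ℕ} (w : Fin b → ℝ) : Measurable (histOf w) :=
  Finset.measurable_sum _ fun a _ => (measurable_binHist b a).const_mul _

lemma isDensity_histOf {b : ℕ} {w : Fin b → ℝ} (hw : w ∈ stdSimplex ℝ (Fin b)) :
    IsDensity unitMeasure (histOf w) := IsDensity.sum isDensity_binHist hw

lemma histOf_mem_hist1 {b : ℕ} {w : Fin b → ℝ} (hw : w ∈ stdSimplex ℝ (Fin b)) :
    histOf w ∈ hist1 b := by
  have h : histOf w = ∑ a, w a • binHist b a := by
    funext x
    simp [histOf]
  rw [h]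
  exact (convex_convexHull ℝ _).sum_mem (fun a _ => hw.1 a) hw.2
    fun a _ => subset_convexHull ℝ _ ⟨a, rfl⟩

lemma integral_abs_histOf_sub_le {b : ℕ} {w v : Fin b → ℝ} (hw : w ∈ stdSimplex ℝ (Fin b)) :
    ∫ x, |histOf w x - histOf v x| ∂unitMeasure ≤ ∑ a, |w a - v a| := by
  have h := integral_abs_mixture_sub_le (ν := unitMeasure) (f := binHist b) (g := binHist b)
    (v := v) (c := 0) isDensity_binHist isDensity_binHist hw (by simp)
  rwa [add_zero] at h

lemma exists_mem_bin {b : ℕ} (hb : 1 ≤ b) {x : ℝ} (hx : x ∈ Set.Ico (0 : ℝ) 1) :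
    ∃ a : Fin b, x ∈ Set.Ico ((a : ℝ) / b) (((a : ℝ) + 1) / b) := by
  have hb' : (0 : ℝ) < b := by exact_mod_cast hb
  have hbx : 0 ≤ x * b := mul_nonneg hx.1 hb'.le
  refine ⟨⟨⌊x * b⌋₊, (Nat.floor_lt hbx).mpr (by nlinarith [hx.2])⟩, ?_, ?_⟩
  · rw [div_le_iff₀ hb']
    exact Nat.floor_le hbx
  · rw [lt_div_iff₀ hb']
    exact Nat.lt_floor_add_one _

lemma bin_unique {b : ℕ} {x : ℝ} {a c : Fin b}
    (ha : x ∈ Set.Ico ((a : ℝ) / b) (((a : ℝ) + 1) / b))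
    (hc : x ∈ Set.Ico ((c : ℝ) / b) (((c : ℝ) + 1) / b)) : a = c := by
  have hb : (0 : ℝ) < b := by exact_mod_cast a.pos
  rw [Set.mem_Ico, div_le_iff₀ hb, lt_div_iff₀ hb] at ha hc
  have h1 : (a : ℝ) < c + 1 := ha.1.trans_lt hc.2
  have h2 : (c : ℝ) < a + 1 := hc.1.trans_lt ha.2
  have h1' : (a : ℕ) < c + 1 := by exact_mod_cast h1
  have h2' : (c : ℕ) < a + 1 := by exact_mod_cast h2
  exact Fin.ext (by omega)

lemma histOf_of_mem_bin {b : ℕ} (w : Fin b → ℝ) {x : ℝ} {a : Fin b}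
    (ha : x ∈ Set.Ico ((a : ℝ) / b) (((a : ℝ) + 1) / b)) : histOf w x = w a * b := by
  rw [histOf, Finset.sum_eq_single a]
  · rw [binHist, Set.indicator_of_mem ha]
  · intro c _ hca
    rw [binHist, Set.indicator_of_notMem, mul_zero]
    exact fun hc => hca (bin_unique hc ha)
  · exact fun h => absurd (Finset.mem_univ a) h

/-- The masses that `f` gives to the bins. -/
noncomputable def binMass (b : ℕ) (f : ℝ → ℝ) (a : Fin b) : ℝ :=
  ∫ x in Set.Ico ((a : ℝ) / b) (((a : ℝ) + 1) / b), f x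

lemma sum_indicator_bin {b : ℕ} (hb : 1 ≤ b) (f : ℝ → ℝ) {x : ℝ} (hx : x ∈ Set.Ico (0 : ℝ) 1) :
    ∑ a : Fin b, (Set.Ico ((a : ℝ) / b) (((a : ℝ) + 1) / b)).indicator f x = f x := by
  obtain ⟨a, ha⟩ := exists_mem_bin hb hx
  rw [Finset.sum_eq_single a, Set.indicator_of_mem ha]
  · intro c _ hca
    exact Set.indicator_of_notMem (fun hc => hca (bin_unique hc ha)) _
  · exact fun h => absurd (Finset.mem_univ a) h

lemma binMass_mem_stdSimplex {b : ℕ} (hb : 1 ≤ b) {L : ℝ≥0} {f : ℝ → ℝ} (hf : f ∈ lipDensity L) :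
    binMass b f ∈ stdSimplex ℝ (Fin b) := by
  have hd := isDensity_of_mem_lipDensity hf
  refine ⟨fun a => setIntegral_nonneg measurableSet_Ico fun x hx =>
    hf.2.1 x (Set.Ico_subset_Icc_self (bin_subset a hx)), ?_⟩
  rw [← hd.integral_eq_one]
  simp_rw [binMass, ← integral_unitMeasure_indicator_bin]
  rw [← integral_finsetSum _ fun a _ => hd.integrable.indicator measurableSet_Ico]
  exact setIntegral_congr_fun measurableSet_Ico fun x hx => sum_indicator_bin hb f hx

/-- On each bin the histogram equals the mean of `f` there, and a Lipschitz `f` varies by at most `L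
/ b` on a bin of length `1 / b`. -/
lemma integral_abs_sub_histOf_binMass_le {b : ℕ} (hb : 1 ≤ b) {L : ℝ≥0} {f : ℝ → ℝ}
    (hf : f ∈ lipDensity L) :
    ∫ x, |f x - histOf (binMass b f) x| ∂unitMeasure ≤ L / b := by
  have hb' : (0 : ℝ) < b := by exact_mod_cast hb
  have hd := isDensity_of_mem_lipDensity hf
  have hh := isDensity_histOf (binMass_mem_stdSimplex hb hf)
  have hpt : ∀ x ∈ Set.Ico (0 : ℝ) 1, |f x - histOf (binMass b f) x| ≤ L / b := by
    intro x hx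
    obtain ⟨a, ha⟩ := exists_mem_bin hb hx
    set I := Set.Ico ((a : ℝ) / b) (((a : ℝ) + 1) / b) with hI
    have hsub : I ⊆ Set.Icc 0 1 := (bin_subset a).trans Set.Ico_subset_Icc_self
    have hvol : volume.real I = 1 / b := by
      rw [hI, Real.volume_real_Ico_of_le (by gcongr; linarith)]
      ring
    have hfi : IntegrableOn f I :=
      (hf.1.continuousOn.integrableOn_compact isCompact_Icc).mono_set hsub
    have hconst : IntegrableOn (fun _ : ℝ => f x) I := integrableOn_const measure_Ico_lt_top.ne
    have h1 : ∫ y in I, (f x - f y) = f x / b - binMass b f a := by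
      rw [integral_sub hconst hfi, setIntegral_const, hvol, smul_eq_mul, binMass]
      ring
    have h2 : |∫ y in I, (f x - f y)| ≤ L / b * volume.real I := by
      rw [← Real.norm_eq_abs]
      refine norm_setIntegral_le_of_norm_le_const measure_Ico_lt_top fun y hy => ?_
      have hxy : |x - y| ≤ 1 / b := by
        have h3 : ((a : ℝ) + 1) / b = a / b + 1 / b := by ring
        rw [hI, Set.mem_Ico, h3] at hy ha
        rw [abs_le]
        constructor <;> linarith [hy.1, hy.2, ha.1, ha.2]
      have h4 := hf.1.dist_le_mul x (hsub ha) y (hsub hy)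
      rw [Real.dist_eq, Real.dist_eq] at h4
      calc ‖f x - f y‖ ≤ L * |x - y| := h4
        _ ≤ L * (1 / b) := by gcongr
        _ = L / b := by ring
    rw [h1, hvol] at h2
    rw [histOf_of_mem_bin _ ha]
    have h5 : f x - binMass b f a * b = (f x / b - binMass b f a) * b := by
      field_simp
    rw [h5, abs_mul, abs_of_pos hb']
    calc _ ≤ (L : ℝ) / b * (1 / b) * b := by gcongr
      _ = L / b := by field_simp
  calc _ ≤ ∫ _ in Set.Ico (0 : ℝ) 1, (L / b : ℝ) :=
        setIntegral_mono_on (hd.integrable.sub hh.integrable).abs (integrable_const _)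
          measurableSet_Ico hpt
    _ = _ := by simp

/-! ### Finite grids of weights and of multi-view histograms -/

/-- Weight vectors with `m` entries that are multiples of `1 / M`. -/
abbrev WeightGrid (M m : ℕ) : Type := {c : Fin m → Fin (M + 1) // ∑ a, (c a : ℕ) = M}

/-- The weight vector of a point of the grid. -/
noncomputable def WeightGrid.weight {M m : ℕ} (c : WeightGrid M m) (a : Fin m) : ℝ :=
  ((c.1 a : ℕ) : ℝ) / M

lemma WeightGrid.weight_mem {M m : ℕ} (hM : 1 ≤ M) (c : WeightGrid M m) :
    c.weight ∈ stdSimplex ℝ (Fin m) := by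
  refine ⟨fun a => by unfold WeightGrid.weight; positivity, ?_⟩
  simp_rw [WeightGrid.weight]
  rw [← Finset.sum_div, ← Nat.cast_sum, c.2, div_self]
  exact_mod_cast (by omega : M ≠ 0)

lemma WeightGrid.card_le (M m : ℕ) : Fintype.card (WeightGrid M m) ≤ (M + 1) ^ m := by
  refine (Fintype.card_subtype_le _).trans ?_
  simp

/-- Round every `M * w a` down and give the whole deficit to entry 0. The deficit is at most `m`; it
is counted once as rounding loss and once as the correction, whence the factor 2. -/
lemma exists_weightGrid_close {M m : ℕ} (hM : 1 ≤ M) (hm : 1 ≤ m) {w : Fin m → ℝ}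
    (hw : w ∈ stdSimplex ℝ (Fin m)) :
    ∃ c : WeightGrid M m, ∑ a, |w a - c.weight a| ≤ 2 * m / M := by
  have hM' : (0 : ℝ) < M := by exact_mod_cast hM
  set i₀ : Fin m := ⟨0, hm⟩
  set r : Fin m → ℕ := fun a => ⌊M * w a⌋₊ with hr
  have hrle : ∀ a, (r a : ℝ) ≤ M * w a := fun a =>
    Nat.floor_le (mul_nonneg hM'.le (hw.1 a))
  have hrlt : ∀ a, M * w a < r a + 1 := fun a => Nat.lt_floor_add_one _
  have hsumM : ∑ a, M * w a = M := by rw [← Finset.mul_sum, hw.2, mul_one]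
  have hsum : ∑ a, r a ≤ M := by
    have : (∑ a, (r a : ℝ)) ≤ M := hsumM ▸ Finset.sum_le_sum fun a _ => hrle a
    exact_mod_cast this
  set q : Fin m → ℕ := fun a => r a + if a = i₀ then M - ∑ a, r a else 0 with hq
  have hqsum : ∑ a, q a = M := by
    simp only [hq, Finset.sum_add_distrib, Finset.sum_ite_eq', Finset.mem_univ, if_true]
    omega
  have hqle : ∀ a, q a < M + 1 := fun a =>
    Nat.lt_succ_of_le (hqsum ▸ Finset.single_le_sum (fun _ _ => Nat.zero_le _) (Finset.mem_univ a))
  refine ⟨⟨fun a => ⟨q a, hqle a⟩, hqsum⟩, ?_⟩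
  have hterm : ∀ a, |w a - (q a : ℝ) / M|
      ≤ ((M * w a - r a) + if a = i₀ then (M : ℝ) - ∑ a, (r a : ℝ) else 0) / M := by
    intro a
    have h1 : w a - (q a : ℝ) / M
        = ((M * w a - r a) - if a = i₀ then (M : ℝ) - ∑ a, (r a : ℝ) else 0) / M := by
      simp only [hq]
      push_cast [hsum]
      field_simp
      ring
    rw [h1, abs_div, abs_of_pos hM']
    gcongr
    refine (abs_sub _ _).trans (le_of_eq ?_)
    rw [abs_of_nonneg (by linarith [hrle a])]
    congr 1
    apply abs_of_nonneg
    split_ifs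
    · have : (∑ a, (r a : ℝ)) ≤ M := by exact_mod_cast hsum
      linarith
    · exact le_rfl
  have hlow : (M : ℝ) - ∑ a, (r a : ℝ) ≤ m := by
    have : ∑ a, M * w a ≤ ∑ a, ((r a : ℝ) + 1) := Finset.sum_le_sum fun a _ => (hrlt a).le
    rw [hsumM, Finset.sum_add_distrib] at this
    simp at this
    linarith
  calc _ ≤ ∑ a, ((M * w a - r a) + if a = i₀ then (M : ℝ) - ∑ a, (r a : ℝ) else 0) / M :=
        Finset.sum_le_sum fun a _ => hterm a
    _ = 2 * (M - ∑ a, (r a : ℝ)) / M := by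
        rw [← Finset.sum_div, Finset.sum_add_distrib, Finset.sum_sub_distrib, hsumM]
        simp
        ring
    _ ≤ _ := by gcongr

lemma exists_mem_stdSimplex_fin {m : ℕ} (hm : 1 ≤ m) : ∃ w, w ∈ stdSimplex ℝ (Fin m) :=
  ⟨_, single_mem_stdSimplex ℝ (⟨0, hm⟩ : Fin m)⟩

lemma WeightGrid.nonempty {M m : ℕ} (hM : 1 ≤ M) (hm : 1 ≤ m) : Nonempty (WeightGrid M m) :=
  let ⟨_, hw⟩ := exists_mem_stdSimplex_fin hm
  let ⟨c, _⟩ := exists_weightGrid_close hM hm hw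
  ⟨c⟩

lemma IsDensity.of_mem_hist1 {b : ℕ} {f : ℝ → ℝ} (hf : f ∈ hist1 b) : IsDensity unitMeasure f := by
  refine convexHull_min ?_ ?_ hf (t := {f | IsDensity unitMeasure f})
  · rintro _ ⟨i, rfl⟩
    exact isDensity_binHist i
  · intro f hf g hg u v hu hv huv
    have h := IsDensity.sum (ν := unitMeasure) (κ := Bool) (f := fun c => if c then f else g)
      (fun c => by cases c <;> simp_all) (w := fun c => if c then u else v)
      ⟨fun c => by cases c <;> simp_all, by simp [huv]⟩
    have hfun : u • f + v • g
        = fun x => ∑ c : Bool, (if c then u else v) * (if c then f else g) x := by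
      funext x
      simp
    rw [hfun]
    exact h

/-- The multi-view histograms whose weights are multiples of `1 / M`. -/
abbrev HistGrid (M d b k : ℕ) : Type := WeightGrid M k × (Fin k → Fin d → WeightGrid M b)

/-- The function on the cube given by a point of the grid of multi-view histograms. -/
noncomputable def HistGrid.toFun {M d b k : ℕ} (c : HistGrid M d b k) (x : Fin d → ℝ) : ℝ :=
  ∑ i, c.1.weight i * ∏ j, histOf (c.2 i j).weight (x j)

lemma HistGrid.toFun_mem {M d b k : ℕ} (hM : 1 ≤ M) (c : HistGrid M d b k) :
    c.toFun ∈ multiViewHist d b k :=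
  ⟨c.1.weight, c.1.weight_mem hM, fun i j => histOf (c.2 i j).weight,
    fun i j => histOf_mem_hist1 ((c.2 i j).weight_mem hM), rfl⟩

lemma HistGrid.measurable_toFun {M d b k : ℕ} (c : HistGrid M d b k) : Measurable c.toFun :=
  Finset.measurable_sum _ fun _ _ => (Finset.measurable_prod _ fun j _ =>
    (measurable_histOf _).comp (measurable_pi_apply j)).const_mul _

lemma HistGrid.card_le (M d b k : ℕ) :
    Fintype.card (HistGrid M d b k) ≤ (M + 1) ^ (k + b * d * k) := by
  rw [Fintype.card_prod, Fintype.card_fun, Fintype.card_fun, Fintype.card_fin, Fintype.card_fin,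
    pow_add, pow_mul, pow_mul]
  gcongr
  · exact WeightGrid.card_le M k
  · exact WeightGrid.card_le M b

/-- Three errors add up: rounding the mixture weights, and in each of the `d` coordinates replacing
a marginal by its bin means and rounding the bin masses. -/
lemma exists_histGrid_close {M d b k : ℕ} (hM : 1 ≤ M) (hb : 1 ≤ b) (hk : 1 ≤ k) {L : ℝ≥0}
    {p : (Fin d → ℝ) → ℝ} (hp : p ∈ lipMultiView d k L) :
    ∃ c : HistGrid M d b k, ∫ x, |c.toFun x - p x| ∂(cubeMeasure d)
      ≤ 2 * k / M + d * (L / b + 2 * b / M) := by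
  obtain ⟨w, hw, f, hf, rfl⟩ := hp
  obtain ⟨v, hv⟩ := exists_weightGrid_close hM hk hw
  choose g hg using fun i j => exists_weightGrid_close hM hb (binMass_mem_stdSimplex hb (hf i j))
  have hfd : ∀ i j, IsDensity unitMeasure (f i j) := fun i j =>
    isDensity_of_mem_lipDensity (hf i j)
  have hgd : ∀ i j, IsDensity unitMeasure (histOf (g i j).weight) := fun i j =>
    isDensity_histOf ((g i j).weight_mem hM)
  refine ⟨(v, g), ?_⟩
  simp_rw [abs_sub_comm (HistGrid.toFun _ _)]
  rw [cubeMeasure_eq_pi]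
  refine (integral_abs_mixture_sub_le (fun i => IsDensity.prod (hfd i))
    (fun i => IsDensity.prod (hgd i)) hw (c := d * (L / b + 2 * b / M)) fun i => ?_).trans
      (by gcongr)
  refine (integral_abs_prod_sub_le (hfd i) (hgd i)).trans ?_
  have h : ∀ j, ∫ x, |f i j x - histOf (g i j).weight x| ∂unitMeasure ≤ L / b + 2 * b / M := by
    intro j
    have hbm := binMass_mem_stdSimplex hb (hf i j)
    refine (integral_abs_sub_triangle (hfd i j).integrable (isDensity_histOf hbm).integrable
      (hgd i j).integrable).trans
      (add_le_add (integral_abs_sub_histOf_binMass_le hb (hf i j))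
        ((integral_abs_histOf_sub_le hbm).trans (hg i j)))
  refine (Finset.sum_le_sum fun j _ => h j).trans (le_of_eq ?_)
  rw [Finset.sum_const, Finset.card_univ, Fintype.card_fin, nsmul_eq_mul]

/-! ### The estimator and its error bound -/

/-- The bound for the `L¹` error of the histogram estimator. -/
noncomputable def histErrorBound (d n b k : ℕ) (L δ : ℝ) : ℝ :=
  3 * (2 * k / n + d * (L / b + 2 * b / n)) +
    4 * (√(2 * (k * d * b) * Real.log (n + 1) / n) + √(Real.log (3 / δ) / (2 * n)))

/-- The estimator is chosen before `L`, `p` and `δ`, which the universal sequence needs. The factor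
`2 / 3` leaves room for a strict inequality after taking the supremum. -/
theorem exists_histEstimator {d b k : ℕ} (n : ℕ) (hd : 1 ≤ d) (hb : 1 ≤ b) (hk : 1 ≤ k) :
    ∃ V : (Fin n → Fin d → ℝ) → (Fin d → ℝ) → ℝ, IsHistEstimator d n b k V ∧
      ∀ L : ℝ≥0, ∀ p ∈ lipMultiView d k L, ∀ δ : ℝ, 1 ≤ n → 0 < δ → δ ≤ 1 →
        sampleMeasure d n p {X | l1Dist d (V X) p > ENNReal.ofReal (histErrorBound d n b k L δ)}
          ≤ ENNReal.ofReal (2 / 3 * δ) := by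
  -- The grid has mesh `1 / n`; the maximum keeps it nonempty for the empty sample.
  have hM : 1 ≤ max n 1 := le_max_right _ _
  have : Nonempty (WeightGrid (max n 1) k) := WeightGrid.nonempty hM hk
  have : Nonempty (WeightGrid (max n 1) b) := WeightGrid.nonempty hM hb
  have hmem : ∀ c : HistGrid (max n 1) d b k, IsDensity (cubeMeasure d) c.toFun := fun c =>
    isDensity_of_mem_multiView (fun _ => IsDensity.of_mem_hist1) (c.toFun_mem hM)
  obtain ⟨s, hs, hsel⟩ := exists_minimum_distance_selector (ν := cubeMeasure d) n
    (HistGrid.toFun (M := max n 1) (d := d) (b := b) (k := k)) HistGrid.measurable_toFun hmem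
  refine ⟨fun X => (s X).toFun, ⟨fun X => (s X).toFun_mem hM, hs⟩, ?_⟩
  intro L p hp δ hn hδ hδ1
  have hn' : (0 : ℝ) < n := by exact_mod_cast hn
  have hMn : max n 1 = n := max_eq_left hn
  have hpd : IsDensity (cubeMeasure d) p :=
    isDensity_of_mem_multiView (fun _ => isDensity_of_mem_lipDensity) hp
  have : IsProbabilityMeasure (densityMeasure d p) := hpd.isProbabilityMeasure
  have : IsProbabilityMeasure (sampleMeasure d n p) := by unfold sampleMeasure; infer_instance
  obtain ⟨c, hc⟩ := exists_histGrid_close (M := max n 1) hM hb hk hp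
  -- In the tolerance `u + v`, the part `u` pays for the square of the number of candidates in the
  -- union bound and `v` pays for the confidence level.
  set u := √(2 * (k * d * b) * Real.log (n + 1) / n) with hu
  set v := √(Real.log (3 / δ) / (2 * n)) with hv
  have hlog : 0 ≤ Real.log (n + 1) := Real.log_nonneg (by linarith)
  have hlogδ : 0 ≤ Real.log (3 / δ) := Real.log_nonneg (by rw [le_div_iff₀ hδ]; linarith)
  have hu2 : u ^ 2 = 2 * (k * d * b) * Real.log (n + 1) / n := Real.sq_sqrt (by positivity)
  have hv2 : v ^ 2 = Real.log (3 / δ) / (2 * n) := Real.sq_sqrt (by positivity)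
  have hprob := hsel p hpd hn (u + v) (by positivity)
  have hcard : (Fintype.card (HistGrid (max n 1) d b k) : ℝ)
      ≤ Real.exp (2 * (k * d * b) * Real.log (n + 1)) := by
    have h1 := HistGrid.card_le (max n 1) d b k
    have h2 : (Fintype.card (HistGrid (max n 1) d b k) : ℝ) ≤ ((n : ℝ) + 1) ^ (k + b * d * k) := by
      rw [hMn] at h1 ⊢
      exact_mod_cast h1
    refine h2.trans ?_
    have h3 : ((n : ℝ) + 1) ^ (k + b * d * k)
        = Real.exp ((k + b * d * k : ℕ) * Real.log (n + 1)) := by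
      rw [Real.exp_nat_mul, Real.exp_log (by positivity)]
    rw [h3]
    gcongr
    have h4 : k * 1 ≤ k * (d * b) := Nat.mul_le_mul_left k (Nat.mul_pos hd hb)
    have h5 : k + b * d * k ≤ 2 * (k * d * b) := by nlinarith
    exact_mod_cast h5
  have hfinal : 2 * (Fintype.card (HistGrid (max n 1) d b k) : ℝ) ^ 2
      * Real.exp (-2 * n * (u + v) ^ 2) ≤ 2 / 3 * δ := by
    have h1 : Real.exp (-2 * n * (u + v) ^ 2)
        ≤ Real.exp (-2 * (2 * (k * d * b) * Real.log (n + 1)) - Real.log (3 / δ)) := by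
      gcongr
      have h2 : (u ^ 2 + v ^ 2) ≤ (u + v) ^ 2 := by
        have : 0 ≤ u * v := by positivity
        nlinarith
      have h3 : 2 * n * (u ^ 2 + v ^ 2)
          = 2 * (2 * (k * d * b) * Real.log (n + 1)) + Real.log (3 / δ) := by
        rw [hu2, hv2]; field_simp
      nlinarith
    calc _ ≤ 2 * Real.exp (2 * (k * d * b) * Real.log (n + 1)) ^ 2 *
          Real.exp (-2 * (2 * (k * d * b) * Real.log (n + 1)) - Real.log (3 / δ)) := by gcongr
      _ = 2 * Real.exp (- Real.log (3 / δ)) := by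
          rw [← Real.exp_nat_mul, mul_assoc, ← Real.exp_add]
          congr 2
          push_cast
          ring
      _ = 2 / 3 * δ := by
          rw [Real.exp_neg, Real.exp_log (by positivity)]
          field_simp
  rw [← ofReal_measureReal]
  apply ENNReal.ofReal_le_ofReal
  refine le_trans (measureReal_mono ?_) (hprob.trans hfinal)
  intro X hX hall
  have hX' : l1Dist d (s X).toFun p > ENNReal.ofReal (histErrorBound d n b k L δ) := hX
  rw [l1Dist_eq_ofReal (hmem _) hpd] at hX'
  refine absurd hX' (not_lt.mpr (ENNReal.ofReal_le_ofReal ((hall c).trans ?_)))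
  have hMn' : ((max n 1 : ℕ) : ℝ) = n := by rw [hMn]
  rw [hMn'] at hc
  rw [histErrorBound]
  gcongr

/-- The parameter `ρ` is the size of the stochastic error: `k / n` and `d * b / n` are both at most
`k * d * b / n`, so every term but the bias and the confidence term is controlled by `ρ`. -/
lemma histErrorBound_le {d n b k : ℕ} (hd : 1 ≤ d) (hn : 1 ≤ n) (hb : 1 ≤ b) (hk : 1 ≤ k)
    {L δ ρ l : ℝ} (hρ : 0 ≤ ρ) (hs : (k : ℝ) * d * b / n ≤ 4 * ρ ^ 2)
    (hl : Real.log (n + 1) ≤ l) :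
    histErrorBound d n b k L δ ≤ 3 * (d * L / b) + 48 * ρ ^ 2 + 12 * (ρ * √l)
      + 4 * √(Real.log (3 / δ) / (2 * n)) := by
  have hn' : (0 : ℝ) < n := by exact_mod_cast hn
  have hd' : (1 : ℝ) ≤ d := by exact_mod_cast hd
  have hb' : (1 : ℝ) ≤ b := by exact_mod_cast hb
  have hk' : (1 : ℝ) ≤ k := by exact_mod_cast hk
  have hlog : 0 ≤ Real.log (n + 1) := Real.log_nonneg (by linarith)
  have h1 : (k : ℝ) / n ≤ k * d * b / n := by
    gcongr
    have : 1 ≤ (d : ℝ) * b := one_le_mul_of_one_le_of_one_le hd' hb'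
    nlinarith
  have h2 : (d : ℝ) * b / n ≤ k * d * b / n := by
    gcongr
    have : 0 ≤ (d : ℝ) * b := by positivity
    nlinarith
  have h3 : √(2 * (k * d * b) * Real.log (n + 1) / n) ≤ 3 * (ρ * √l) := by
    refine Real.sqrt_le_iff.mpr ⟨by positivity, ?_⟩
    have h4 : 2 * ((k : ℝ) * d * b) * Real.log (n + 1) / n
        = 2 * (k * d * b / n) * Real.log (n + 1) := by ring
    rw [h4, mul_pow, mul_pow, Real.sq_sqrt (hlog.trans hl)]
    calc _ ≤ 2 * (4 * ρ ^ 2) * l := by gcongr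
      _ ≤ 3 ^ 2 * (ρ ^ 2 * l) := by nlinarith [mul_nonneg (sq_nonneg ρ) (hlog.trans hl)]
  have h5 : (3 : ℝ) * (2 * k / n + d * (L / b + 2 * b / n))
      = 3 * (d * L / b) + 6 * (k / n) + 6 * (d * b / n) := by ring
  rw [histErrorBound, h5]
  linarith

/-- Two densities are never at `L¹` distance more than 2, so a threshold `T ≥ 2` is harmless. Later
arguments may therefore assume `T < 2`. -/
lemma exists_histEstimator_iSup_lt {d n b k : ℕ} (hd : 1 ≤ d) (hn : 1 ≤ n) (hb : 1 ≤ b)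
    (hk : 1 ≤ k) {L : ℝ≥0} {δ T : ℝ} (hδ : 0 < δ) (hδ1 : δ ≤ 1)
    (hT : 2 ≤ T ∨ histErrorBound d n b k L δ ≤ T) :
    ∃ V : (Fin n → Fin d → ℝ) → (Fin d → ℝ) → ℝ, IsHistEstimator d n b k V ∧
      (⨆ p ∈ lipMultiView d k L, sampleMeasure d n p {X | l1Dist d (V X) p > ENNReal.ofReal T})
        < ENNReal.ofReal δ := by
  obtain ⟨V, hV, hbound⟩ := exists_histEstimator n hd hb hk
  refine ⟨V, hV, lt_of_le_of_lt (iSup₂_le fun p hp => ?_)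
    ((ENNReal.ofReal_lt_ofReal_iff hδ).mpr (by linarith : 2 / 3 * δ < δ))⟩
  rcases hT with hT | hT
  · have hempty : {X | l1Dist d (V X) p > ENNReal.ofReal T} = ∅ := by
      refine Set.eq_empty_of_forall_notMem fun X hX => ?_
      have hpd : IsDensity (cubeMeasure d) p :=
        isDensity_of_mem_multiView (fun _ => isDensity_of_mem_lipDensity) hp
      have hVd : IsDensity (cubeMeasure d) (V X) :=
        isDensity_of_mem_multiView (fun _ => IsDensity.of_mem_hist1) (hV.mem X)
      have hX' : l1Dist d (V X) p > ENNReal.ofReal T := hX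
      rw [l1Dist_eq_ofReal hVd hpd] at hX'
      exact absurd hX' (not_lt.mpr (ENNReal.ofReal_le_ofReal
        ((hVd.integral_abs_sub_le_two hpd).trans hT)))
    rw [hempty, measure_empty]
    exact zero_le
  · refine le_trans (measure_mono fun X hX => ?_) (hbound L p hp δ hn hδ hδ1)
    exact lt_of_le_of_lt (ENNReal.ofReal_le_ofReal hT) hX

/-- Pad with components of weight zero. Their marginals must still lie in the class, so those of the
first component are reused; it exists since the weights sum to one. -/
lemma lipMultiView_mono (d : ℕ) {k k' : ℕ} (h : k ≤ k') (L : ℝ≥0) :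
    lipMultiView d k L ⊆ lipMultiView d k' L := by
  obtain ⟨m, rfl⟩ := Nat.exists_eq_add_of_le h
  rintro p ⟨w, hw, f, hf, rfl⟩
  have hk : 0 < k := by
    rcases Nat.eq_zero_or_pos k with rfl | hk
    · simpa using hw.2
    · exact hk
  refine ⟨Fin.append w 0, ⟨fun i => ?_, ?_⟩, Fin.append f fun _ => f ⟨0, hk⟩, fun i => ?_, ?_⟩
  · refine Fin.addCases (fun i => ?_) (fun i => ?_) i
    · simpa using hw.1 i
    · simp
  · rw [Fin.sum_univ_add]
    simpa using hw.2
  · refine Fin.addCases (fun i => ?_) (fun i => ?_) i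
    · simpa using hf i
    · simpa using hf ⟨0, hk⟩
  · funext x
    rw [Fin.sum_univ_add]
    simp

/-! ### Choice of the number of bins for a given Lipschitz constant -/

lemma rpow_third_pow {x : ℝ} (hx : 0 ≤ x) : (x ^ (1 / 3 : ℝ)) ^ 3 = x := by
  rw [← Real.rpow_natCast, ← Real.rpow_mul hx]
  norm_num

lemma ceil_three_mul_le {β : ℝ} (hβ : 1 ≤ β) :
    1 ≤ ⌈3 * β⌉₊ ∧ 3 * β ≤ ⌈3 * β⌉₊ ∧ (⌈3 * β⌉₊ : ℝ) ≤ 4 * β :=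
  ⟨Nat.one_le_ceil_iff.mpr (by linarith), Nat.le_ceil _,
    (Nat.ceil_lt_add_one (by linarith)).le.trans (by linarith)⟩

lemma exists_bins_of_two_le_lip {d n k : ℕ} (hd : 1 ≤ d) (hn : 1 ≤ n) (hk : 1 ≤ k) {L δ T : ℝ}
    (hL : 2 ≤ L)
    (hT : T = 21 * d * (k : ℝ) ^ (1 / 3 : ℝ) * L ^ (((d : ℝ) + 3) / 12)
        / (n : ℝ) ^ (1 / 3 : ℝ) * √(Real.log (3 * L * d * k * n))
          + 7 * √(Real.log (3 / δ) / (2 * n))) :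
    ∃ b : ℕ, 1 ≤ b ∧ (2 ≤ T ∨ histErrorBound d n b k L δ ≤ T) := by
  rcases le_or_gt 2 T with h2T | hT2
  · exact ⟨1, le_rfl, Or.inl h2T⟩
  have hn' : (1 : ℝ) ≤ n := by exact_mod_cast hn
  have hd' : (1 : ℝ) ≤ d := by exact_mod_cast hd
  have hk' : (1 : ℝ) ≤ k := by exact_mod_cast hk
  set l := Real.log (3 * L * d * k * n) with hl
  have hdkn : (n : ℝ) ≤ d * k * n := by
    have : 1 ≤ (d : ℝ) * k := one_le_mul_of_one_le_of_one_le hd' hk'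
    nlinarith
  have h6n : 6 * (n : ℝ) ≤ 3 * L * d * k * n := by
    calc 6 * (n : ℝ) ≤ 3 * L * (d * k * n) := by gcongr; linarith
      _ = _ := by ring
  have hln : Real.log (n + 1) ≤ l := Real.log_le_log (by linarith) (by linarith)
  have hl1 : 1 ≤ l := by
    rw [hl, Real.le_log_iff_exp_le (by linarith)]
    linarith [Real.exp_one_lt_d9]
  have hy1 : 1 ≤ √l := Real.one_le_sqrt.mpr hl1
  set κ := (k : ℝ) ^ (1 / 3 : ℝ) / (n : ℝ) ^ (1 / 3 : ℝ) with hκ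
  have hκ0 : 0 < κ := by positivity
  have hκ3 : κ ^ 3 = k / n := by
    rw [hκ, div_pow, rpow_third_pow (by positivity), rpow_third_pow (by positivity)]
  set lam := L ^ (1 / 3 : ℝ) with hlam
  have hlam3 : lam ^ 3 = L := rpow_third_pow (by linarith)
  have hlam1 : 1 ≤ lam := Real.one_le_rpow (by linarith) (by norm_num)
  set Q := d * κ * L ^ (((d : ℝ) + 3) / 12) with hQ
  have hlamQ : d * κ * lam ≤ Q := by
    rw [hQ]
    gcongr
    exact Real.rpow_le_rpow_of_exponent_le (by linarith) (by linarith)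
  set v := √(Real.log (3 / δ) / (2 * n)) with hv
  have hv0 : 0 ≤ v := Real.sqrt_nonneg _
  have hTQ : T = 21 * (Q * √l) + 7 * v := by rw [hT, hQ, hκ]; ring
  have hQ0 : 0 ≤ Q := by positivity
  have hQy : Q * √l < 2 / 21 := by linarith
  have hQle : Q ≤ Q * √l := le_mul_of_one_le_right hQ0 hy1
  -- This `β` balances bias and stochastic error: `R = d * L / β` satisfies `R ^ 2 = d * β * k / n`.
  -- Taking about `3 * β` bins absorbs the factor 3 lost in selection.
  set β := (d * L ^ 2) ^ (1 / 3 : ℝ) / κ with hβ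
  have hβ0 : 0 < β := by positivity
  have hβ3 : β ^ 3 * κ ^ 3 = d * L ^ 2 := by
    rw [← mul_pow, hβ, div_mul_cancel₀ _ hκ0.ne', rpow_third_pow (by positivity)]
  have hβlam : lam ^ 2 ≤ β * κ := by
    refine le_of_pow_le_pow_left₀ (n := 3) (by norm_num) (by positivity) ?_
    rw [mul_pow, hβ3, ← pow_mul, mul_comm 2 3, pow_mul, hlam3]
    exact le_mul_of_one_le_left (by positivity) hd'
  have hκ1 : κ ≤ 1 := by
    have : κ * 1 ≤ d * κ * lam := by
      rw [mul_comm (d : ℝ) κ, mul_assoc]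
      gcongr
      exact one_le_mul_of_one_le_of_one_le hd' hlam1
    linarith
  have hβ1 : 1 ≤ β := by
    have h1 : 1 ≤ lam ^ 2 := one_le_pow₀ hlam1
    have h2 : β * κ ≤ β := mul_le_of_le_one_right hβ0.le hκ1
    linarith
  set R := d * L / β with hR
  have hR0 : 0 ≤ R := by positivity
  have hR2 : R ^ 2 = d * β * κ ^ 3 := by
    rw [hR, div_pow, div_eq_iff (by positivity)]
    have : (d * L) ^ 2 = d * (d * L ^ 2) := by ring
    rw [this, ← hβ3]
    ring
  have hRQ : R ≤ Q := by
    refine le_trans ?_ hlamQ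
    rw [hR, div_le_iff₀ hβ0]
    calc (d : ℝ) * L = d * lam * lam ^ 2 := by rw [← hlam3]; ring
      _ ≤ d * lam * (β * κ) := by gcongr
      _ = _ := by ring
  obtain ⟨hb1, hb3, hb4⟩ := ceil_three_mul_le hβ1
  refine ⟨⌈3 * β⌉₊, hb1, Or.inr ?_⟩
  set b := ⌈3 * β⌉₊
  have hs : (k : ℝ) * d * b / n ≤ 4 * R ^ 2 := by
    calc (k : ℝ) * d * b / n = d * κ ^ 3 * b := by rw [hκ3]; ring
      _ ≤ d * κ ^ 3 * (4 * β) := by gcongr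
      _ = 4 * R ^ 2 := by rw [hR2]; ring
  refine (histErrorBound_le hd hn hb1 hk hR0 hs hln).trans ?_
  have hbias : 3 * (d * L / b) ≤ R := by
    calc 3 * (d * L / b) ≤ 3 * (d * L / (3 * β)) := by gcongr
      _ = R := by rw [hR]; field_simp
  -- Here `T < 2` enters: it forces `Q * √l < 2 / 21`, which makes the quadratic term linear in `Q`.
  have hRsq : R ^ 2 ≤ Q * (2 / 21) := by
    rw [pow_two]
    gcongr
    linarith
  have hRy : R * √l ≤ Q * √l := by gcongr
  rw [hTQ]
  linarith

lemma log_seven_ge : 1.9 ≤ Real.log 7 := by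
  have h1 : Real.log ((2 : ℝ) ^ 14) ≤ Real.log ((7 : ℝ) ^ 5) :=
    Real.log_le_log (by norm_num) (by norm_num)
  rw [Real.log_pow, Real.log_pow] at h1
  have := Real.log_two_gt_d9
  norm_num at h1 ⊢
  linarith

/-- If `d * L ^ 2 ≤ 25 * l`, the logarithmic term alone suffices. Otherwise `d * L ^ 2` is large,
also compared with `log d`, and the exponential alone dominates. -/
lemma sqrt_mul_le_exp_add {d L l : ℝ} (hd : 1 ≤ d) (hL0 : 0 ≤ L) (hL2 : L ≤ 2)
    (hl : Real.log (7 * d) ≤ l) :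
    √d * L ≤ L ^ (1 / 3 : ℝ) * Real.exp (L ^ 2 * (d - 1) / 24) + 5 * √l := by
  have hlog7 := log_seven_ge
  rw [Real.log_mul (by norm_num) (by linarith)] at hl
  have hlogd : 0 ≤ Real.log d := Real.log_nonneg hd
  have hE : 0 ≤ L ^ (1 / 3 : ℝ) * Real.exp (L ^ 2 * (d - 1) / 24) := by positivity
  rcases le_or_gt (d * L ^ 2) (25 * l) with h | h
  · have h1 : √d * L ≤ 5 * √l := by
      refine le_of_pow_le_pow_left₀ (n := 2) (by norm_num) (by positivity) ?_
      rw [mul_pow, mul_pow, Real.sq_sqrt (by linarith), Real.sq_sqrt (by linarith)]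
      linarith
    linarith
  · have hL : 0 < L := by
      rcases hL0.eq_or_lt with rfl | hL
      · simp at h; linarith
      · exact hL
    have hd0 : 0 < d := by linarith
    have ht : 0 < d * L ^ 2 := by positivity
    have hlogt : Real.log (d * L ^ 2) = Real.log d + 2 * Real.log L := by
      rw [Real.log_mul hd0.ne' (by positivity), Real.log_pow]
      norm_num
    -- The tangent to the logarithm at 64, where `log 64 - 1 < 3.16`.
    have hlogt' : Real.log (d * L ^ 2) ≤ 3.16 + d * L ^ 2 / 64 := by
      have h1 := Real.log_le_sub_one_of_pos (x := d * L ^ 2 / 2 ^ 6) (by positivity)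
      rw [Real.log_div ht.ne' (by norm_num), Real.log_pow] at h1
      have := Real.log_two_lt_d9
      norm_num at h1 ⊢
      linarith
    have hmain : √d * L ≤ L ^ (1 / 3 : ℝ) * Real.exp (L ^ 2 * (d - 1) / 24) := by
      rw [← Real.log_le_log_iff (by positivity) (by positivity),
        Real.log_mul (by positivity) hL.ne', Real.log_sqrt hd0.le,
        Real.log_mul (by positivity) (by positivity), Real.log_rpow hL, Real.log_exp]
      have h1 : L ^ 2 * (d - 1) / 24 = d * L ^ 2 / 24 - L ^ 2 / 24 := by ring
      have h2 : L ^ 2 ≤ 2 ^ 2 := pow_le_pow_left₀ hL0 hL2 2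
      rw [h1]
      linarith
    have : 0 ≤ √l := Real.sqrt_nonneg _
    linarith

lemma exists_bins_of_lip_le_two {d n k : ℕ} (hd : 1 ≤ d) (hn : 1 ≤ n) (hk : 1 ≤ k) {L δ T : ℝ}
    (hL0 : 0 ≤ L) (hL2 : L ≤ 2)
    (hT : T = √(d : ℝ) * ((k : ℝ) ^ (1 / 3 : ℝ) / (n : ℝ) ^ (1 / 3 : ℝ))
        * (L ^ (1 / 3 : ℝ) * Real.exp (L ^ 2 * ((d : ℝ) - 1) / 24)
          + 20 * √(Real.log (7 * d * n * k)))
        + 7 * √(Real.log (3 / δ) / (2 * n))) :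
    ∃ b : ℕ, 1 ≤ b ∧ (2 ≤ T ∨ histErrorBound d n b k L δ ≤ T) := by
  rcases le_or_gt 2 T with h2T | hT2
  · exact ⟨1, le_rfl, Or.inl h2T⟩
  have hn' : (1 : ℝ) ≤ n := by exact_mod_cast hn
  have hd' : (1 : ℝ) ≤ d := by exact_mod_cast hd
  have hk' : (1 : ℝ) ≤ k := by exact_mod_cast hk
  set l := Real.log (7 * d * n * k) with hl
  have hnk : 1 ≤ (n : ℝ) * k := one_le_mul_of_one_le_of_one_le hn' hk'
  have hdk : 1 ≤ (d : ℝ) * k := one_le_mul_of_one_le_of_one_le hd' hk'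
  have h7d : 7 * (d : ℝ) ≤ 7 * d * n * k := by
    rw [mul_assoc _ (n : ℝ)]
    exact le_mul_of_one_le_right (by positivity) hnk
  have h7n : 7 * (n : ℝ) ≤ 7 * d * n * k := by
    have : 7 * (d : ℝ) * n * k = 7 * n * (d * k) := by ring
    rw [this]
    exact le_mul_of_one_le_right (by positivity) hdk
  have hln : Real.log (n + 1) ≤ l := Real.log_le_log (by linarith) (by linarith)
  have hld : Real.log (7 * d) ≤ l := Real.log_le_log (by linarith) h7d
  have hl1 : 1.9 ≤ l := by
    have h : Real.log 7 ≤ Real.log (7 * d) := Real.log_le_log (by norm_num) (by linarith)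
    linarith [log_seven_ge]
  set y := √l with hy
  have hy2 : y ^ 2 = l := Real.sq_sqrt (by linarith)
  have hy1 : 1 ≤ y := Real.one_le_sqrt.mpr (by linarith)
  set κ := (k : ℝ) ^ (1 / 3 : ℝ) / (n : ℝ) ^ (1 / 3 : ℝ) with hκ
  have hκ0 : 0 < κ := by positivity
  have hκ3 : κ ^ 3 = k / n := by
    rw [hκ, div_pow, rpow_third_pow (by positivity), rpow_third_pow (by positivity)]
  set W := L ^ (1 / 3 : ℝ) * Real.exp (L ^ 2 * ((d : ℝ) - 1) / 24) with hW
  have hW0 : 0 ≤ W := by positivity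
  have hLW : √(d : ℝ) * L ≤ W + 5 * y := sqrt_mul_le_exp_add hd' hL0 hL2 hld
  set v := √(Real.log (3 / δ) / (2 * n)) with hv
  have hv0 : 0 ≤ v := Real.sqrt_nonneg _
  set ρ := √(d : ℝ) * κ with hρ
  have hρ0 : 0 ≤ ρ := by positivity
  have hρ2 : ρ ^ 2 = d * κ ^ 2 := by rw [hρ, mul_pow, Real.sq_sqrt (by linarith)]
  have hρW : 0 ≤ ρ * W := by positivity
  have hTW : T = ρ * W + 20 * (ρ * y) + 7 * v := by rw [hT]; ring
  have hρy : ρ * y < 1 / 10 := by linarith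
  have hρle : ρ ≤ ρ * y := le_mul_of_one_le_right hρ0 hy1
  have hκρ : κ ≤ ρ := le_mul_of_one_le_left hκ0.le (Real.one_le_sqrt.mpr hd')
  -- The number of bins is about `3 / κ`, regardless of `d` and `L`; the bias `d * L * κ = ρ * (√d *
  -- L)` is then handled by `sqrt_mul_le_exp_add`.
  have hβ1 : 1 ≤ 1 / κ := by rw [le_div_iff₀ hκ0]; linarith
  obtain ⟨hb1, hb3, hb4⟩ := ceil_three_mul_le hβ1
  refine ⟨⌈3 * (1 / κ)⌉₊, hb1, Or.inr ?_⟩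
  set b := ⌈3 * (1 / κ)⌉₊
  have hs : (k : ℝ) * d * b / n ≤ 4 * ρ ^ 2 := by
    calc (k : ℝ) * d * b / n = d * κ ^ 3 * b := by rw [hκ3]; ring
      _ ≤ d * κ ^ 3 * (4 * (1 / κ)) := by gcongr
      _ = 4 * ρ ^ 2 := by rw [hρ2]; field_simp
  refine (histErrorBound_le hd hn hb1 hk hρ0 hs hln).trans ?_
  have hbias : 3 * (d * L / b) ≤ ρ * (√(d : ℝ) * L) := by
    calc 3 * (d * L / b) ≤ 3 * (d * L / (3 * (1 / κ))) := by gcongr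
      _ = (√(d : ℝ) * √(d : ℝ)) * L * κ := by
        rw [Real.mul_self_sqrt (by linarith)]; field_simp
      _ = _ := by rw [hρ]; ring
  have hbias' : ρ * (√(d : ℝ) * L) ≤ ρ * W + 5 * (ρ * y) :=
    (mul_le_mul_of_nonneg_left hLW hρ0).trans (le_of_eq (by ring))
  -- From `ρ * y < 1 / 10` and `l ≥ 1.9`: `4.8 ≤ 5.7`. The coefficients of `ρ * y` then add up to `5
  -- + 3 + 12 = 20`.
  have h48 : 48 * ρ ≤ 3 * y := by
    have : 48 * ρ * y ≤ 3 * y * y := by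
      have h1 : 3 * y * y = 3 * l := by rw [← hy2]; ring
      have h2 : 48 * ρ * y = 48 * (ρ * y) := by ring
      linarith
    exact le_of_mul_le_mul_right this (by linarith)
  have h48' : 48 * ρ ^ 2 ≤ 3 * (ρ * y) := by
    calc 48 * ρ ^ 2 = ρ * (48 * ρ) := by ring
      _ ≤ ρ * (3 * y) := mul_le_mul_of_nonneg_left h48 hρ0
      _ = _ := by ring
  rw [hTW]
  linarith

/-! ### One sequence of estimators for all mixtures -/

/-- A number of components that grows more slowly than the logarithm of the sample size. -/
noncomputable def slowComponents (n : ℕ) : ℕ := ⌈√(Real.log (n + 1))⌉₊ + 1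

/-- A number of bins of the order of the cube root of the sample size. -/
noncomputable def cubeRootBins (n : ℕ) : ℕ := ⌈(n : ℝ) ^ (1 / 3 : ℝ)⌉₊ + 1

lemma one_le_slowComponents (n : ℕ) : 1 ≤ slowComponents n := Nat.le_add_left 1 _

lemma one_le_cubeRootBins (n : ℕ) : 1 ≤ cubeRootBins n := Nat.le_add_left 1 _

lemma tendsto_slowComponents : Tendsto slowComponents atTop atTop := by
  refine tendsto_atTop_mono (fun n => Nat.le_succ _) (tendsto_nat_ceil_atTop.comp ?_)
  exact Real.tendsto_sqrt_atTop.comp (Real.tendsto_log_atTop.comp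
    (tendsto_atTop_add_const_right _ _ tendsto_natCast_atTop_atTop))

/-- With `z = (log n) ^ (1 / 4)` and `a = n ^ (1 / 3)`, the number of components is of order `z ^ 2`
and the whole error is at most a constant times `z ^ 3 / a`. Since `log n = z ^ 4`, the spare factor
`z` eventually beats the constant. -/
lemma eventually_histErrorBound_le {d : ℕ} (hd : 1 ≤ d) {L : ℝ} (hL : 0 ≤ L) :
    ∀ᶠ n : ℕ in atTop, histErrorBound d n (cubeRootBins n) (slowComponents n) L (1 / n)
      ≤ (n : ℝ) ^ (-(1 / 3) : ℝ) * Real.log n := by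
  have hlim : Tendsto (fun n : ℕ => √(√(Real.log n))) atTop atTop :=
    Real.tendsto_sqrt_atTop.comp (Real.tendsto_sqrt_atTop.comp
      (Real.tendsto_log_atTop.comp tendsto_natCast_atTop_atTop))
  -- The threshold is the sum of the constants from the four error terms; `n ≥ 3` gives `log n ≥ 1`,
  -- `n + 1 ≤ n ^ 2` and `3 * n ≤ n ^ 2`.
  filter_upwards [hlim.eventually_ge_atTop (3 * d * L + 144 * d + 72 * d + 8),
    eventually_ge_atTop 3] with n hz hn
  have hd' : (1 : ℝ) ≤ d := by exact_mod_cast hd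
  have hn3 : (3 : ℝ) ≤ n := by exact_mod_cast hn
  set y := Real.log n with hy
  set z := √(√y) with hzdef
  have hdL : 0 ≤ d * L := by positivity
  have hz1 : 1 ≤ z := by linarith
  have hy1 : 1 ≤ y := by
    rw [hy, Real.le_log_iff_exp_le (by linarith)]
    linarith [Real.exp_one_lt_d9]
  have hz2 : z ^ 2 = √y := Real.sq_sqrt (Real.sqrt_nonneg _)
  have hz4 : z ^ 4 = y := by
    rw [show z ^ 4 = (z ^ 2) ^ 2 by ring, hz2, Real.sq_sqrt (by linarith)]
  have hz23 : z ^ 2 ≤ z ^ 3 := pow_le_pow_right₀ hz1 (by norm_num)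
  have hz03 : 1 ≤ z ^ 3 := one_le_pow₀ hz1
  set a := (n : ℝ) ^ (1 / 3 : ℝ) with ha
  have ha1 : 1 ≤ a := Real.one_le_rpow (by linarith) (by norm_num)
  have ha3 : a ^ 3 = n := rpow_third_pow (by linarith)
  have hainv : (n : ℝ) ^ (-(1 / 3) : ℝ) = 1 / a := by
    rw [Real.rpow_neg (by linarith), one_div (a : ℝ)]
  have hlog : Real.log (n + 1) ≤ 2 * y := by
    rw [hy, ← Real.log_rpow (by linarith) 2]
    refine Real.log_le_log (by linarith) ?_
    norm_num
    nlinarith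
  have hb : (cubeRootBins n : ℝ) ≤ 3 * a := by
    have := Nat.ceil_lt_add_one (a := a) (by linarith)
    rw [cubeRootBins]
    push_cast
    linarith
  have hba : a ≤ cubeRootBins n := by
    have := Nat.le_ceil a
    rw [cubeRootBins]
    push_cast
    linarith
  have hk : (slowComponents n : ℝ) ≤ 4 * z ^ 2 := by
    have h1 := Nat.ceil_lt_add_one (Real.sqrt_nonneg (Real.log (n + 1)))
    have h2 : √(Real.log (n + 1)) ≤ 2 * z ^ 2 := by
      refine Real.sqrt_le_iff.mpr ⟨by positivity, ?_⟩
      have : (2 * z ^ 2) ^ 2 = 4 * y := by rw [← hz4]; ring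
      linarith
    have h3 : 1 ≤ z ^ 2 := one_le_pow₀ hz1
    rw [slowComponents]
    push_cast
    linarith
  have hρ : (slowComponents n : ℝ) * d * cubeRootBins n / n ≤ 4 * (√(3 * d) * z / a) ^ 2 := by
    rw [div_pow, mul_pow, Real.sq_sqrt (by positivity), ← ha3]
    calc _ ≤ 4 * z ^ 2 * d * (3 * a) / a ^ 3 := by gcongr
      _ = _ := by field_simp
  have hmain := histErrorBound_le (L := L) (δ := 1 / n) hd (by omega : 1 ≤ n)
    (one_le_cubeRootBins n) (one_le_slowComponents n)
    (by positivity) hρ hlog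
  have h1 : 3 * (d * L / cubeRootBins n) ≤ (3 * d * L) * z ^ 3 / a := by
    calc 3 * (d * L / cubeRootBins n) ≤ 3 * (d * L / a) := by gcongr
      _ = 3 * d * L * 1 / a := by ring
      _ ≤ _ := by gcongr
  have h2 : 48 * (√(3 * d) * z / a) ^ 2 ≤ 144 * d * z ^ 3 / a := by
    rw [div_pow, mul_pow, Real.sq_sqrt (by positivity)]
    have haa : a ≤ a ^ 2 := le_self_pow₀ ha1 (by norm_num)
    calc 48 * (3 * d * z ^ 2 / a ^ 2) ≤ 48 * (3 * d * z ^ 3 / a) := by gcongr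
      _ = 144 * d * z ^ 3 / a := by ring
  have h3 : 12 * (√(3 * d) * z / a * √(2 * y)) ≤ 72 * d * z ^ 3 / a := by
    have h4 : √(3 * d) ≤ 3 * d := Real.sqrt_le_iff.mpr ⟨by positivity, by nlinarith⟩
    have h5 : √(2 * y) ≤ 2 * z ^ 2 := by
      refine Real.sqrt_le_iff.mpr ⟨by positivity, ?_⟩
      have : (2 * z ^ 2) ^ 2 = 4 * y := by rw [← hz4]; ring
      linarith
    calc _ ≤ 12 * (3 * d * z / a * (2 * z ^ 2)) := by gcongr
      _ = _ := by ring
  have h6 : 4 * √(Real.log (3 / (1 / n)) / (2 * n)) ≤ 8 * z ^ 3 / a := by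
    have h7 : Real.log (3 / (1 / n)) ≤ 2 * y := by
      rw [div_div_eq_mul_div, div_one, hy, ← Real.log_rpow (by linarith) 2]
      refine Real.log_le_log (by linarith) ?_
      norm_num
      nlinarith
    have h8 : √(Real.log (3 / (1 / n)) / (2 * n)) ≤ z ^ 2 / a := by
      refine Real.sqrt_le_iff.mpr ⟨by positivity, ?_⟩
      calc _ ≤ 2 * y / (2 * n) := by gcongr
        _ = z ^ 4 / a ^ 3 := by rw [hz4, ha3]; field_simp
        _ ≤ z ^ 4 / a ^ 2 := by
          have : a ^ 2 ≤ a ^ 3 := pow_le_pow_right₀ ha1 (by norm_num)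
          gcongr
        _ = _ := by ring
    calc _ ≤ 4 * (z ^ 2 / a) := by gcongr
      _ ≤ 8 * (z ^ 3 / a) := by gcongr; norm_num
      _ = _ := by ring
  calc _ ≤ _ := hmain
    _ ≤ 3 * d * L * z ^ 3 / a + 144 * d * z ^ 3 / a + 72 * d * z ^ 3 / a + 8 * z ^ 3 / a := by
      linarith
    _ = 1 / a * ((3 * d * L + 144 * d + 72 * d + 8) * z ^ 3) := by ring
    _ ≤ 1 / a * (z * z ^ 3) := by gcongr
    _ = _ := by rw [hainv, ← hz4]; ring

theorem exists_adaptive_histEstimator {d : ℕ} (hd : 1 ≤ d) :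
    ∃ (b k : ℕ → ℕ) (V : ∀ n : ℕ, (Fin n → Fin d → ℝ) → (Fin d → ℝ) → ℝ),
      Tendsto k atTop atTop ∧ (∀ n, IsHistEstimator d n (b n) (k n) (V n)) ∧
      ∀ p ∈ allLipMultiView d,
        Tendsto
          (fun n : ℕ => sampleMeasure d n p
            {X | l1Dist d (V n X) p >
              ENNReal.ofReal ((n : ℝ) ^ (-(1 / 3) : ℝ) * Real.log n)})
          atTop (𝓝 0) := by
  choose V hV hbound using fun n : ℕ => exists_histEstimator (d := d) (b := cubeRootBins n)
    (k := slowComponents n) n hd (one_le_cubeRootBins n) (one_le_slowComponents n)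
  refine ⟨cubeRootBins, slowComponents, V, tendsto_slowComponents, hV, ?_⟩
  rintro p ⟨k, L, hp⟩
  have hlim : Tendsto (fun n : ℕ => ENNReal.ofReal (2 / 3 * (1 / (n : ℝ)))) atTop (𝓝 0) := by
    have h := ENNReal.tendsto_ofReal
      ((tendsto_one_div_atTop_nhds_zero_nat (𝕜 := ℝ)).const_mul (2 / 3 : ℝ))
    simpa using h
  refine tendsto_of_tendsto_of_tendsto_of_le_of_le' tendsto_const_nhds hlim
    (Eventually.of_forall fun _ => zero_le) ?_
  -- Once `slowComponents n` reaches the number of components of `p`, padding places `p` in the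
  -- class of the estimator; confidence level `1 / n` makes the failure probability vanish.
  filter_upwards [eventually_histErrorBound_le hd L.coe_nonneg, eventually_ge_atTop 1,
    tendsto_slowComponents.eventually_ge_atTop k] with n herr hn hk
  have hn' : (1 : ℝ) ≤ n := by exact_mod_cast hn
  refine le_trans (measure_mono fun X hX => ?_)
    (hbound n L p (lipMultiView_mono d hk L hp) (1 / n) hn (by positivity)
      (by rw [div_le_one (by linarith)]; exact hn'))
  exact lt_of_le_of_lt (ENNReal.ofReal_le_ofReal herr) hX

theorem theorem2p6 (d : ℕ) (hd : 1 ≤ d) :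
    -- Lipschitz constant at least two
    (∀ (n k : ℕ) (L : ℝ≥0) (δ : ℝ), 1 ≤ n → 1 ≤ k → 2 ≤ L → 0 < δ → δ ≤ 1 →
      ∃ (b : ℕ) (V : (Fin n → Fin d → ℝ) → (Fin d → ℝ) → ℝ),
        1 ≤ b ∧ IsHistEstimator d n b k V ∧
        (⨆ p ∈ lipMultiView d k L, sampleMeasure d n p
          {X | l1Dist d (V X) p >
            ENNReal.ofReal
              (21 * d * (k : ℝ) ^ (1 / 3 : ℝ) * (L : ℝ) ^ (((d : ℝ) + 3) / 12)
                  / (n : ℝ) ^ (1 / 3 : ℝ) * √(Real.log (3 * L * d * k * n))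
                + 7 * √(Real.log (3 / δ) / (2 * n)))}) < ENNReal.ofReal δ) ∧
    -- Lipschitz constant at most two
    (∀ (n k : ℕ) (L : ℝ≥0) (δ : ℝ), 1 ≤ n → 1 ≤ k → L ≤ 2 → 0 < δ → δ ≤ 1 →
      ∃ (b : ℕ) (V : (Fin n → Fin d → ℝ) → (Fin d → ℝ) → ℝ),
        1 ≤ b ∧ IsHistEstimator d n b k V ∧
        (⨆ p ∈ lipMultiView d k L, sampleMeasure d n p
          {X | l1Dist d (V X) p >
            ENNReal.ofReal
              (√(d : ℝ) * ((k : ℝ) ^ (1 / 3 : ℝ) / (n : ℝ) ^ (1 / 3 : ℝ))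
                  * ((L : ℝ) ^ (1 / 3 : ℝ) * Real.exp ((L : ℝ) ^ 2 * ((d : ℝ) - 1) / 24)
                    + 20 * √(Real.log (7 * d * n * k)))
                + 7 * √(Real.log (3 / δ) / (2 * n)))}) < ENNReal.ofReal δ) ∧
    -- one sequence of estimators attains the rate for every density of the large class
    (∃ (b k : ℕ → ℕ) (V : ∀ n : ℕ, (Fin n → Fin d → ℝ) → (Fin d → ℝ) → ℝ),
      Tendsto k atTop atTop ∧ (∀ n, IsHistEstimator d n (b n) (k n) (V n)) ∧
      ∀ p ∈ allLipMultiView d,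
        Tendsto
          (fun n : ℕ => sampleMeasure d n p
            {X | l1Dist d (V n X) p >
              ENNReal.ofReal ((n : ℝ) ^ (-(1 / 3) : ℝ) * Real.log n)})
          atTop (𝓝 0)) := by
  refine ⟨fun n k L δ hn hk hL hδ hδ1 => ?_, fun n k L δ hn hk hL hδ hδ1 => ?_,
    exists_adaptive_histEstimator hd⟩
  · obtain ⟨b, hb, hT⟩ := exists_bins_of_two_le_lip (δ := δ) hd hn hk
      (by exact_mod_cast hL : (2 : ℝ) ≤ L) rfl
    obtain ⟨V, hV, hlt⟩ := exists_histEstimator_iSup_lt hd hn hb hk hδ hδ1 hT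
    exact ⟨b, V, hb, hV, hlt⟩
  · obtain ⟨b, hb, hT⟩ := exists_bins_of_lip_le_two (δ := δ) hd hn hk
      L.coe_nonneg (by exact_mod_cast hL : (L : ℝ) ≤ 2) rfl
    obtain ⟨V, hV, hlt⟩ := exists_histEstimator_iSup_lt hd hn hb hk hδ hδ1 hT
    exact ⟨b, V, hb, hV, hlt⟩
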